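/- Let $U=\{z\in\mathbb C:|z|<1\}$, and for $1\le p\le\infty$ let $\|g\|_p=\lim_{r\uparrow1}\big(\frac1{2\pi}\int_0^{2\pi}|g(re^{i\theta})|^p\,d\theta\big)^{1/p}$ (for $p=\infty$: $\lim_{r\uparrow 1}\sup_\theta|g(re^{i\theta})|$) be the norm of the Hardy space $H^p$ on $U$. For an infinite set $E\subset U$, $\varepsilon>0$ and $0<R<1$ put $$C_p(\varepsilon,R)=\sup\Big\{\sup_{|z|\le R}|g(z)|:\ g\in H^p,\ \|g\|_p\le1,\ |g(\zeta)|\le\varepsilon\ \ \forall\zeta\in E\Big\}.$$ Condition (B): $E$ contains a sequence of distinct points $z_j$ with $\sum_j(1-|z_j|)=\infty$. Condition (G): the set of all $\zeta\in\partial U$ for which there are $z_n\in E$ with $z_n\to\zeta$ and $|z_n-\zeta|=O(1-|z_n|)$ has arc length measure zero. A *weight* for $E$ is a holomorphic function $q$ on $U$ without zeros, with $\sup_U|q|=1$, such that $q(z)\to0$ as $|z|\to1$, $z\in E$, and such that $q\equiv1$ if $\overline E\cap\partial U=\emptyset$. Write $E^*=\overline E\cap U$. For $n\ge 1$ and $Z_n=(z_1,\dots,z_n)\in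 (E^*)^n$ put $$B_q(Z_n,z)=q(z)\prod_{j=1}^n\frac{z-z_j}{1-\overline{z_j}z},\qquad V(Z_n)=\prod_{j=1}^n|B_q(Z_{j-1},z_j)|,\qquad M(Z_n)=\sup_{z\in E}|B_q(Z_n,z)|,$$ where $Z_{j-1}=(z_1,\dots,z_{j-1})$ and empty products are $1$, and let $$V_n(E)=\sup_{Z_n\in (E^*)^n}V(Z_n),\qquad M_n(E)=\inf\{M(Z_n):Z_n\in (E^*)^n,\ V(Z_n)=V_n(E)\},$$ $$g_R(\varepsilon)=\sup\Big\{\Big(|q(0)|\prod_{j=1}^n\max\{R,|z_j|\}\Big)^{s}:\ s,n\ge1,\ Z_n\in (E^*)^n,\ M(Z_n)^s\le\varepsilon\Big\}.$$ A *majorant* is a continuous nonincreasing $h:[1,\infty)\to(0,\infty)$ with $h(x)\to0$ as $x\to\infty$ and $M_n(E)\le h(n)$ for all $n\ge1$. For $0<\varepsilon\le h(1)/2$ let $\varphi(\varepsilon)=h(x)$, where $x\ge1$ is the unique solution of $\varepsilon=h(x)/(x+1)$. Here $[\cdot]$ denotes the integer part. **Theorem.** Let $0<R<1$. There is $\alpha>0$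 depending only on $R$ with the following property. Let $E\subset U$ be an infinite set satisfying (G). Then $E$ has a weight, and for every weight $q$ for $E$ the following holds. The function $g_R:(0,1]\to(0,\infty)$ is positive and nondecreasing, and (i) if $E$ satisfies (B), then $\lim_{\varepsilon\to0}g_R(\varepsilon)=0$; (ii) $g_R(\varepsilon)^{[\kappa]+1}\le g_R(\varepsilon^\kappa)\le g_R(\varepsilon)^{\frac1{[1/\kappa]+1}}$ for all $\varepsilon\in(0,1]$ and $\kappa>0$. A majorant exists. For every $1\le p\le\infty$ there is $C>0$ (depending on $R,E,q,p$ only) such that: (iii) for every majorant $h$ there is $\varepsilon_0\in(0,h(1)/2]$ such that for all $\varepsilon\in(0,\varepsilon_0)$ we have $0<\varphi(\varepsilon)\le1$ and $$g_R(\varepsilon)\le C_p(\varepsilon,R)\le C\,g_R(\varphi(\varepsilon))^{\alpha};$$ (iv) if there are constants $A$, $N$ and $\sigma>0$ with $M_n(E)\le A n^{-\sigma}$ for all $n\ge N$, then, with $\kappa_0=\frac{\sigma}{1+\sigma}$, there is $\varepsilon_0>0$ such that for all $\varepsilon\in(0,\varepsilon_0)$ $$g_R(\varepsilon)\le C_p(\varepsilon,R)\le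 C\,g_R(\varepsilon)^{\frac{\alpha}{[1/\kappa_0]+1}}.$$ -/

import Mathlib

open Set Filter Topology MeasureTheory
open scoped ENNReal ComplexConjugate

namespace HardyStability

noncomputable section

/-- The open unit disc of the complex plane. -/
def unitDisc : Set ℂ := Metric.ball 0 1

/-- Uniform probability measure on one period of the angle. -/
def angleMeasure : Measure ℝ :=
  ENNReal.ofReal (1 / (2 * Real.pi)) • volume.restrict (Ioc 0 (2 * Real.pi))

/-- The `p`-th integral mean of `|g|` over the circle of radius `r`
(for `p = ∞`, the supremum over that circle when `g` is continuous). -/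
def circleMean (p : ℝ≥0∞) (g : ℂ → ℂ) (r : ℝ) : ℝ≥0∞ :=
  eLpNorm (fun θ : ℝ => g (r * Complex.exp (θ * Complex.I))) p angleMeasure

/-- The `H^p` norm, the limit of the means as `r ↑ 1`. For holomorphic `g` the means are
nondecreasing in `r`, so that the upper limit is a limit. -/
def hardyNorm (p : ℝ≥0∞) (g : ℂ → ℂ) : ℝ≥0∞ :=
  limsup (circleMean p g) (𝓝[<] (1 : ℝ))

/-- The quantity `C_p(ε, R)` of the set `E`: the largest value on `|z| ≤ R` of the modulus of a
function in the unit ball of `H^p` that is at most `ε` in modulus on `E`. -/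
def stabilityConst (E : Set ℂ) (p : ℝ≥0∞) (ε R : ℝ) : ℝ :=
  sSup {x : ℝ | ∃ g : ℂ → ℂ, DifferentiableOn ℂ g unitDisc ∧ hardyNorm p g ≤ 1 ∧
    (∀ ζ ∈ E, ‖g ζ‖ ≤ ε) ∧ ∃ z : ℂ, ‖z‖ ≤ R ∧ x = ‖g z‖}

/-- `E` contains a non-Blaschke sequence (of distinct points). -/
def ContainsNonBlaschke (E : Set ℂ) : Prop :=
  ∃ z : ℕ → ℂ, Function.Injective z ∧ (∀ j, z j ∈ E) ∧ ¬ Summable (fun j => 1 - ‖z j‖)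

/-- The set `E₀` of nontangential limit points of `E` on the unit circle. -/
def nontangentialLimitPoints (E : Set ℂ) : Set ℂ :=
  {ζ : ℂ | ‖ζ‖ = 1 ∧ ∃ z : ℕ → ℂ, (∀ n, z n ∈ E) ∧ Tendsto z atTop (𝓝 ζ) ∧
    (fun n => z n - ζ) =O[atTop] (fun n => 1 - ‖z n‖)}

/-- Condition (G): the nontangential limit points of `E` form a null set for arc length. -/
def ConditionG (E : Set ℂ) : Prop :=
  angleMeasure {θ : ℝ | Complex.exp (θ * Complex.I) ∈ nontangentialLimitPoints E} = 0

/-- The functions `q` with respect to which generalized Blaschke products are formed: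
holomorphic and zero-free on the disc, of supremum norm `1`, tending to `0` along `E` at the unit
circle; and `q ≡ 1` if the closure of `E` does not meet the unit circle. -/
structure IsWeight (E : Set ℂ) (q : ℂ → ℂ) : Prop where
  holomorphic : DifferentiableOn ℂ q unitDisc
  ne_zero : ∀ z ∈ unitDisc, q z ≠ 0
  norm_eq_one : IsLUB ((fun z => ‖q z‖) '' unitDisc) 1
  tendsto_zero : ∀ δ : ℝ, 0 < δ → ∃ ρ : ℝ, ρ < 1 ∧ ∀ z ∈ E, ρ < ‖z‖ → ‖q z‖ < δ
  eq_one : Disjoint (closure E) (Metric.sphere (0 : ℂ) 1) → ∀ z ∈ unitDisc, q z = 1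

/-- The Blaschke factor `(z - a) / (1 - conj a * z)`. -/
def blaschkeFactor (a z : ℂ) : ℂ := (z - a) / (1 - conj a * z)

/-- The generalized Blaschke product `B_q(Z_n, z)`. -/
def genBlaschke (q : ℂ → ℂ) {n : ℕ} (Z : Fin n → ℂ) (z : ℂ) : ℂ :=
  (∏ j, blaschkeFactor (Z j) z) * q z

/-- The points of the disc in the closure of `E`. -/
def relClosure (E : Set ℂ) : Set ℂ := closure E ∩ unitDisc

/-- `V(Z_n) = ∏_j |B_q(Z_{j-1}, z_j)|`, where `Z_{j-1} = (z_1, …, z_{j-1})`. -/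
def vandermonde (q : ℂ → ℂ) {n : ℕ} (Z : Fin n → ℂ) : ℝ :=
  ∏ j, ‖(∏ i ∈ Finset.Iio j, blaschkeFactor (Z i) (Z j)) * q (Z j)‖

/-- `M(Z_n) = sup_{z ∈ E} |B_q(Z_n, z)|`. -/
def maxOn (E : Set ℂ) (q : ℂ → ℂ) {n : ℕ} (Z : Fin n → ℂ) : ℝ :=
  sSup ((fun z => ‖genBlaschke q Z z‖) '' E)

/-- `V_n(E)`, the supremum of `V` over `n`-tuples. -/
def vMax (E : Set ℂ) (q : ℂ → ℂ) (n : ℕ) : ℝ :=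
  sSup {v : ℝ | ∃ Z : Fin n → ℂ, (∀ j, Z j ∈ relClosure E) ∧ v = vandermonde q Z}

/-- `M_n(E)`, the infimum of `M` over the `n`-tuples at which `V` attains `V_n(E)`. -/
def mMin (E : Set ℂ) (q : ℂ → ℂ) (n : ℕ) : ℝ :=
  sInf {m : ℝ | ∃ Z : Fin n → ℂ, (∀ j, Z j ∈ relClosure E) ∧
    vandermonde q Z = vMax E q n ∧ m = maxOn E q Z}

/-- A continuous positive nonincreasing majorant of the sequence `M_n(E)`, tending to `0`. -/
structure IsMajorant (E : Set ℂ) (q : ℂ → ℂ) (h : ℝ → ℝ) : Prop where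
  continuousOn : ContinuousOn h (Ici 1)
  pos : ∀ x, 1 ≤ x → 0 < h x
  antitoneOn : AntitoneOn h (Ici 1)
  tendsto_zero : Tendsto h atTop (𝓝 0)
  le : ∀ n : ℕ, 1 ≤ n → mMin E q n ≤ h n

/-- `φ(ε) = h(x)` where `x ≥ 1` is the solution of `ε = h(x) / (x + 1)`. -/
def phi (h : ℝ → ℝ) (ε : ℝ) : ℝ :=
  h (Function.invFunOn (fun x => h x / (x + 1)) (Ici 1) ε)

/-- The function `g_R`. -/
def gFun (E : Set ℂ) (q : ℂ → ℂ) (R ε : ℝ) : ℝ :=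
  sSup {x : ℝ | ∃ (s n : ℕ) (Z : Fin n → ℂ), 1 ≤ s ∧ 1 ≤ n ∧ (∀ j, Z j ∈ relClosure E) ∧
    maxOn E q Z ^ s ≤ ε ∧ x = (‖q 0‖ * ∏ j, max R ‖Z j‖) ^ s}

/-- The defining property of `φ`. -/
theorem phi_apply {h : ℝ → ℝ} (hpos : ∀ x, 1 ≤ x → 0 < h x) (hanti : AntitoneOn h (Ici 1))
    {x : ℝ} (hx : 1 ≤ x) : phi h (h x / (x + 1)) = h x := by
  have key : ∀ a b : ℝ, 1 ≤ a → a < b → h b / (b + 1) < h a / (a + 1) := by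
    intro a b ha hab
    have h1 : h b ≤ h a := hanti (mem_Ici.2 ha) (mem_Ici.2 (ha.trans hab.le)) hab.le
    have h2 := hpos a ha
    rw [div_lt_div_iff₀ (by linarith) (by linarith)]
    nlinarith
  have hmem : ∃ y ∈ Ici (1 : ℝ), (fun x => h x / (x + 1)) y = h x / (x + 1) := ⟨x, hx, rfl⟩
  have h1 := Function.invFunOn_mem hmem
  have h2 := Function.invFunOn_eq hmem
  unfold phi
  congr 1
  rcases lt_trichotomy (Function.invFunOn (fun x => h x / (x + 1)) (Ici 1) (h x / (x + 1))) x
    with h3 | h3 | h3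
  · exact absurd h2 (key _ _ h1 h3).ne'
  · exact h3
  · exact absurd h2 (key _ _ hx h3).ne

end

end HardyStability

open HardyStability

/-! ### Blaschke factors: modulus identities and uniform bounds. -/

namespace HardyStability

/-! Lower bound for `stabilityConst`: if M(Z)^s ≤ ε, then B_q(Z, ·)^s is admissible for every p.
Replacing its Blaschke factors with zeros in |z| < R by functions of the same modulus on |z| = R and
of value R at 0, the maximum principle yields a point of that circle where B_q(Z, ·) is at least
|q(0)| ∏ max{R, |z_j|} (`exists_le_norm_genBlaschke`).

Upper bound: tuples maximising V act as Fekete points. Adding a point of E to an extremal n-tuple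
gives V_n M_n ≤ V_{n+1}; deleting z_j from an extremal (n+1)-tuple gives V_{n+1} ≤ V_n |B_q(Z
without z_j, z_j)|. Hence M_n bounds all these omit-one values from below
(`mMin_le_norm_genBlaschke`). If |g| ≤ ε on E and (n+1)ε ≤ M_n, the interpolant L of g built from
the omit-one products is bounded by 1. The difference g - L vanishes at the n+1 points, so on |z| ≤
R it is at most 2/(1-R) times their Blaschke product, and there each factor is at most max{R, |a|}^α
(`norm_le_of_mul_le_mMin`). Taking n+1 to be the first index with M_{n+1} ≤ φ(ε) brings in
g_R(φ(ε))^α. For M_n = O(n^{-σ}) a power majorant makes φ(ε) at most a power of ε, and (ii) turns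
this into a power of g_R(ε).

The decay of q along E keeps extremal tuples in a compact part of the disc; this gives both their
existence and M_n → 0 (`tendsto_mMin`). A weight is exp(-f) up to normalisation, where f is the
Herglotz integral of a finite measure accumulating on the boundary arcs seen from E; condition (G)
makes the measure finite (`exists_re_tendsto_atTop`). That g_R → 0 under (B) follows from Lagrange
interpolation at a fixed finite part of a non-Blaschke sequence (`exists_stabilityConst_le_prod`).
-/

theorem mem_unitDisc {z : ℂ} : z ∈ unitDisc ↔ ‖z‖ < 1 := by
  simp [unitDisc]

theorem isOpen_unitDisc : IsOpen unitDisc := Metric.isOpen_ball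

theorem one_sub_norm_mul_le (a z : ℂ) : 1 - ‖a‖ * ‖z‖ ≤ ‖1 - conj a * z‖ := by
  have h := norm_sub_norm_le (1 : ℂ) (conj a * z)
  rwa [norm_one, norm_mul, RCLike.norm_conj] at h

theorem one_sub_conj_mul_ne_zero {a z : ℂ} (ha : ‖a‖ < 1) (hz : ‖z‖ ≤ 1) :
    1 - conj a * z ≠ 0 := by
  have h := one_sub_norm_mul_le a z
  have h2 : ‖a‖ * ‖z‖ < 1 := by nlinarith [norm_nonneg a, norm_nonneg z]
  exact norm_pos_iff.1 (by linarith)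

/-- The pseudohyperbolic identity, from which all later bounds on Blaschke factors, above and below,
are read off. -/
theorem one_sub_sq_norm_blaschkeFactor {a z : ℂ} (ha : ‖a‖ < 1) (hz : ‖z‖ ≤ 1) :
    1 - ‖blaschkeFactor a z‖ ^ 2 = (1 - ‖a‖ ^ 2) * (1 - ‖z‖ ^ 2) / ‖1 - conj a * z‖ ^ 2 := by
  have hne : ‖1 - conj a * z‖ ^ 2 ≠ 0 :=
    pow_ne_zero _ (norm_ne_zero_iff.2 (one_sub_conj_mul_ne_zero ha hz))
  rw [blaschkeFactor, norm_div, div_pow, eq_div_iff hne, sub_mul, div_mul_cancel₀ _ hne, one_mul]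
  simp only [Complex.sq_norm, Complex.normSq_apply, Complex.sub_re, Complex.sub_im,
    Complex.mul_re, Complex.mul_im, Complex.conj_re, Complex.conj_im, Complex.one_re,
    Complex.one_im]
  ring

theorem norm_blaschkeFactor_le_one {a z : ℂ} (ha : ‖a‖ < 1) (hz : ‖z‖ ≤ 1) :
    ‖blaschkeFactor a z‖ ≤ 1 := by
  have h := one_sub_sq_norm_blaschkeFactor ha hz
  have h2 : 0 ≤ (1 - ‖a‖ ^ 2) * (1 - ‖z‖ ^ 2) / ‖1 - conj a * z‖ ^ 2 := by
    refine div_nonneg (mul_nonneg ?_ ?_) (sq_nonneg _) <;> nlinarith [norm_nonneg a, norm_nonneg z]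
  nlinarith [norm_nonneg (blaschkeFactor a z)]

/-- Upper bound for the modulus of a Blaschke factor away from the unit circle. -/
theorem sq_norm_blaschkeFactor_le {a z : ℂ} (ha : ‖a‖ < 1) (hz : ‖z‖ ≤ 1) :
    ‖blaschkeFactor a z‖ ^ 2 ≤ 1 - (1 - ‖a‖ ^ 2) * (1 - ‖z‖ ^ 2) / 4 := by
  have h := one_sub_sq_norm_blaschkeFactor ha hz
  have hpos : 0 < ‖1 - conj a * z‖ := norm_pos_iff.2 (one_sub_conj_mul_ne_zero ha hz)
  have h4 : ‖1 - conj a * z‖ ≤ 2 := by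
    refine (norm_sub_le _ _).trans ?_
    rw [norm_one, norm_mul, RCLike.norm_conj]
    nlinarith [norm_nonneg a, norm_nonneg z]
  have h0 : 0 ≤ (1 - ‖a‖ ^ 2) * (1 - ‖z‖ ^ 2) :=
    mul_nonneg (by nlinarith [norm_nonneg a]) (by nlinarith [norm_nonneg z])
  have : (1 - ‖a‖ ^ 2) * (1 - ‖z‖ ^ 2) / 4 ≤
      (1 - ‖a‖ ^ 2) * (1 - ‖z‖ ^ 2) / ‖1 - conj a * z‖ ^ 2 :=
    div_le_div_of_nonneg_left h0 (by positivity) (by nlinarith)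
  linarith

/-- This symmetry makes V independent of the order of the points. -/
theorem norm_blaschkeFactor_comm (a z : ℂ) : ‖blaschkeFactor a z‖ = ‖blaschkeFactor z a‖ := by
  unfold blaschkeFactor
  rw [norm_div, norm_div, norm_sub_rev z a]
  congr 1
  rw [← RCLike.norm_conj (1 - conj a * z)]
  congr 1
  simp [mul_comm]

theorem blaschkeFactor_self (a : ℂ) : blaschkeFactor a a = 0 := by simp [blaschkeFactor]

theorem blaschkeFactor_ne_zero {a z : ℂ} (ha : ‖a‖ < 1) (hz : ‖z‖ ≤ 1) (hne : z ≠ a) :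
    blaschkeFactor a z ≠ 0 :=
  div_ne_zero (sub_ne_zero.2 hne) (one_sub_conj_mul_ne_zero ha hz)

theorem differentiableOn_blaschkeFactor {a : ℂ} (ha : ‖a‖ < 1) :
    DifferentiableOn ℂ (blaschkeFactor a) unitDisc := by
  intro z hz
  refine DifferentiableAt.differentiableWithinAt ?_
  unfold blaschkeFactor
  have := one_sub_conj_mul_ne_zero ha (mem_unitDisc.1 hz).le
  fun_prop (disch := assumption)

/-- A uniform bound below `1` on products of a compact part of the disc with itself. -/
theorem exists_norm_blaschkeFactor_le {ρ : ℝ} (hρ : ρ < 1) :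
    ∃ c : ℝ, 0 ≤ c ∧ c < 1 ∧ ∀ a z : ℂ, ‖a‖ ≤ ρ → ‖z‖ ≤ ρ → ‖blaschkeFactor a z‖ ≤ c := by
  rcases lt_or_ge ρ 0 with h0 | h0
  · exact ⟨0, le_rfl, one_pos, fun a z ha _ => absurd (norm_nonneg a) (by linarith)⟩
  refine ⟨√(1 - (1 - ρ ^ 2) ^ 2 / 4), Real.sqrt_nonneg _, ?_, fun a z ha hz => ?_⟩
  · rw [Real.sqrt_lt' one_pos]
    have : 0 < 1 - ρ ^ 2 := by nlinarith
    nlinarith [sq_pos_of_pos this]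
  · refine Real.le_sqrt_of_sq_le ((sq_norm_blaschkeFactor_le (ha.trans_lt hρ)
      (hz.trans hρ.le)).trans ?_)
    have h1 : 1 - ρ ^ 2 ≤ 1 - ‖a‖ ^ 2 := by nlinarith [norm_nonneg a]
    have h2 : 1 - ρ ^ 2 ≤ 1 - ‖z‖ ^ 2 := by nlinarith [norm_nonneg z]
    have h3 : 0 ≤ 1 - ρ ^ 2 := by nlinarith
    nlinarith [mul_le_mul h1 h2 h3 (h3.trans h1)]

/-- The exponent in the comparison of Blaschke factors with powers of `max R |a|`. -/
theorem norm_blaschkeFactor_le_max_rpow {R : ℝ} (hR0 : 0 < R) (hR1 : R < 1) {a z : ℂ}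
    (ha : ‖a‖ < 1) (hz : ‖z‖ ≤ R) :
    ‖blaschkeFactor a z‖ ≤ max R ‖a‖ ^ (R ^ 2 * (1 - R ^ 2) / 4) := by
  set t := max R ‖a‖ with ht
  have htR : R ≤ t := le_max_left _ _
  have hta : ‖a‖ ≤ t := le_max_right _ _
  have ht1 : t < 1 := max_lt hR1 ha
  have ht0 : 0 < t := hR0.trans_le htR
  -- The factor (1 - R²)/4 comes from 1 - |z|² ≥ 1 - R² and |1 - conj a z| ≤ 2. The factor R² ≤ t²
  -- absorbs the 1/t² in log t² ≥ -(1 - t²)/t².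
  set α := R ^ 2 * (1 - R ^ 2) / 4 with hα
  have hRR : 0 < 1 - R ^ 2 := by nlinarith
  have hα0 : 0 < α := by positivity
  have h1 := sq_norm_blaschkeFactor_le ha (hz.trans hR1.le)
  have h2 : (1 - t ^ 2) * (1 - R ^ 2) ≤ (1 - ‖a‖ ^ 2) * (1 - ‖z‖ ^ 2) := by
    refine mul_le_mul ?_ ?_ hRR.le ?_ <;> nlinarith [norm_nonneg a, norm_nonneg z]
  have h3 : ‖blaschkeFactor a z‖ ^ 2 ≤ Real.exp (-((1 - t ^ 2) * (1 - R ^ 2) / 4)) := by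
    have := Real.add_one_le_exp (-((1 - t ^ 2) * (1 - R ^ 2) / 4))
    linarith
  have h4 : -(1 - t ^ 2) / t ^ 2 ≤ Real.log (t ^ 2) := by
    have := Real.one_sub_inv_le_log_of_pos (show 0 < t ^ 2 by positivity)
    have e : -(1 - t ^ 2) / t ^ 2 = 1 - (t ^ 2)⁻¹ := by field_simp; ring
    linarith
  have h5 : Real.exp (-((1 - t ^ 2) * (1 - R ^ 2) / 4)) ≤ (t ^ α) ^ 2 := by
    rw [← Real.rpow_natCast (t ^ α) 2, ← Real.rpow_mul ht0.le, mul_comm α, Real.rpow_mul ht0.le,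
      Real.rpow_natCast, Real.rpow_def_of_pos (by positivity)]
    refine Real.exp_le_exp.2 ?_
    have h6 : -(1 - t ^ 2) / t ^ 2 * α ≤ Real.log (t ^ 2) * α :=
      mul_le_mul_of_nonneg_right h4 hα0.le
    refine le_trans ?_ h6
    have h7 : -(1 - t ^ 2) / t ^ 2 * α = -((1 - t ^ 2) * (1 - R ^ 2) / 4 * (R ^ 2 / t ^ 2)) := by
      rw [hα]; field_simp
    rw [h7, neg_le_neg_iff]
    refine mul_le_of_le_one_right ?_ ?_
    · have : 0 < 1 - t ^ 2 := by nlinarith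
      positivity
    · rw [div_le_one (by positivity)]
      nlinarith
  exact le_of_sq_le_sq (h3.trans h5) (Real.rpow_nonneg ht0.le _)

/-- Blaschke factors have modulus close to `1` near the unit circle. -/
theorem tendsto_norm_blaschkeFactor {a : ℂ} (ha : ‖a‖ < 1) {η : ℝ} (hη : 0 < η) :
    ∀ᶠ r in 𝓝[<] (1 : ℝ), ∀ z : ℂ, ‖z‖ = r → 1 - η ≤ ‖blaschkeFactor a z‖ := by
  have h1 : Tendsto (fun r : ℝ => (1 - ‖a‖ ^ 2) * (1 - r ^ 2) / (1 - ‖a‖) ^ 2) (𝓝[<] 1) (𝓝 0) := by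
    have : ContinuousAt (fun r : ℝ => (1 - ‖a‖ ^ 2) * (1 - r ^ 2) / (1 - ‖a‖) ^ 2) 1 := by
      fun_prop
    have h2 := this.tendsto
    simp only [one_pow, sub_self, mul_zero, zero_div] at h2
    exact h2.mono_left nhdsWithin_le_nhds
  filter_upwards [h1.eventually (gt_mem_nhds hη), self_mem_nhdsWithin] with r hr hr1 z hz
  have hz1 : ‖z‖ < 1 := by rw [hz]; exact hr1
  have h := one_sub_sq_norm_blaschkeFactor ha hz1.le
  have hle := norm_blaschkeFactor_le_one ha hz1.le
  have h0 : 0 ≤ (1 - ‖a‖ ^ 2) * (1 - ‖z‖ ^ 2) :=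
    mul_nonneg (by nlinarith [norm_nonneg a]) (by nlinarith [norm_nonneg z])
  have h3 : (1 - ‖a‖ ^ 2) * (1 - ‖z‖ ^ 2) / ‖1 - conj a * z‖ ^ 2 ≤
      (1 - ‖a‖ ^ 2) * (1 - ‖z‖ ^ 2) / (1 - ‖a‖) ^ 2 := by
    refine div_le_div_of_nonneg_left h0 (by nlinarith) ?_
    have := one_sub_norm_mul_le a z
    exact pow_le_pow_left₀ (by linarith) (by nlinarith [norm_nonneg a, norm_nonneg z]) 2
  rw [← hz] at hr
  nlinarith [norm_nonneg (blaschkeFactor a z)]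

end HardyStability
-- Integral means, division by zeros, and error bounds for interpolation.
namespace HardyStability

/-- Induction with `dslope`: dividing out one zero leaves the other, distinct zeros in place. -/
theorem exists_eq_prod_sub_mul (S : Finset ℂ) : ∀ f : ℂ → ℂ, DifferentiableOn ℂ f unitDisc →
    (∀ a ∈ S, a ∈ unitDisc ∧ f a = 0) →
    ∃ F : ℂ → ℂ, DifferentiableOn ℂ F unitDisc ∧ ∀ z, f z = (∏ a ∈ S, (z - a)) * F z := by
  classical
  induction S using Finset.induction_on with
  | empty => exact fun f hf _ => ⟨f, hf, fun z => by simp⟩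
  | insert a S haS ih =>
    intro f hf h0
    have ha := h0 a (Finset.mem_insert_self _ _)
    have hd : DifferentiableOn ℂ (dslope f a) unitDisc :=
      (Complex.differentiableOn_dslope (isOpen_unitDisc.mem_nhds ha.1)).2 hf
    have hmul : ∀ z, f z = (z - a) * dslope f a z := fun z => by
      have := sub_smul_dslope f a z
      rw [ha.2, sub_zero, smul_eq_mul] at this
      exact this.symm
    obtain ⟨F, hF, hFm⟩ := ih (dslope f a) hd (fun b hb => by
      have hb' := h0 b (Finset.mem_insert_of_mem hb)
      refine ⟨hb'.1, ?_⟩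
      have h := hmul b
      rw [hb'.2] at h
      refine (mul_eq_zero.1 h.symm).resolve_left (sub_ne_zero.2 ?_)
      rintro rfl
      exact haS hb)
    refine ⟨F, hF, fun z => ?_⟩
    rw [Finset.prod_insert haS, hmul z, hFm z, mul_assoc]

/-- Division of a holomorphic function by the Blaschke product of finitely many of its zeros. -/
theorem exists_eq_prod_blaschkeFactor_mul (S : Finset ℂ) {f : ℂ → ℂ}
    (hf : DifferentiableOn ℂ f unitDisc) (hS : ∀ a ∈ S, a ∈ unitDisc ∧ f a = 0) :
    ∃ F : ℂ → ℂ, DifferentiableOn ℂ F unitDisc ∧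
      ∀ z ∈ unitDisc, f z = (∏ a ∈ S, blaschkeFactor a z) * F z := by
  obtain ⟨F, hF, hm⟩ := exists_eq_prod_sub_mul S f hf hS
  refine ⟨fun z => (∏ a ∈ S, (1 - conj a * z)) * F z, ?_, fun z hz => ?_⟩
  · refine DifferentiableOn.mul ?_ hF
    exact Differentiable.differentiableOn (by fun_prop)
  · rw [hm z, ← mul_assoc, ← Finset.prod_mul_distrib]
    congr 1
    refine Finset.prod_congr rfl fun a ha => ?_
    rw [blaschkeFactor, div_mul_cancel₀]
    exact one_sub_conj_mul_ne_zero (mem_unitDisc.1 (hS a ha).1) (mem_unitDisc.1 hz).le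

instance : IsProbabilityMeasure angleMeasure := by
  constructor
  rw [angleMeasure, Measure.smul_apply, Measure.restrict_apply_univ, Real.volume_Ioc, sub_zero,
    smul_eq_mul, ← ENNReal.ofReal_mul (by positivity), one_div,
    inv_mul_cancel₀ (by positivity), ENNReal.ofReal_one]

theorem norm_mul_exp_mul_I {r : ℝ} (hr : 0 ≤ r) (θ : ℝ) :
    ‖(r : ℂ) * Complex.exp (θ * Complex.I)‖ = r := by
  rw [norm_mul, Complex.norm_exp_ofReal_mul_I, mul_one, Complex.norm_real, Real.norm_of_nonneg hr]

theorem continuous_comp_circle {f : ℂ → ℂ} (hf : ContinuousOn f unitDisc) {r : ℝ}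
    (hr0 : 0 ≤ r) (hr1 : r < 1) :
    Continuous fun θ : ℝ => f (r * Complex.exp (θ * Complex.I)) := by
  refine hf.comp_continuous (by fun_prop) fun θ => ?_
  rw [mem_unitDisc, norm_mul_exp_mul_I hr0]
  exact hr1

/-- Means over a probability measure increase with p, so every p ≥ 1 reduces to p = 1 without a
constant. -/
theorem circleMean_one_le {f : ℂ → ℂ} (hf : ContinuousOn f unitDisc) {r : ℝ}
    (hr0 : 0 ≤ r) (hr1 : r < 1) {p : ℝ≥0∞} (hp : 1 ≤ p) :
    circleMean 1 f r ≤ circleMean p f r :=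
  eLpNorm_le_eLpNorm_of_exponent_le hp (continuous_comp_circle hf hr0 hr1).aestronglyMeasurable

theorem integral_norm_le_of_circleMean_le {f : ℂ → ℂ} (hf : ContinuousOn f unitDisc) {r K : ℝ}
    (hr0 : 0 ≤ r) (hr1 : r < 1) (hK : 0 ≤ K) (h : circleMean 1 f r ≤ ENNReal.ofReal K) :
    ∫ θ in (0 : ℝ)..(2 * Real.pi), ‖f (r * Complex.exp (θ * Complex.I))‖ ≤ 2 * Real.pi * K := by
  have hc := continuous_comp_circle hf hr0 hr1
  rw [circleMean, eLpNorm_one_eq_lintegral_enorm, angleMeasure, lintegral_smul_measure,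
    ← ofReal_integral_norm_eq_lintegral_enorm, smul_eq_mul, ← ENNReal.ofReal_mul (by positivity),
    ENNReal.ofReal_le_ofReal_iff hK] at h
  · rw [intervalIntegral.integral_of_le (by positivity)]
    have h2 : 0 < 2 * Real.pi := by positivity
    rw [one_div, inv_mul_le_iff₀ h2] at h
    exact h
  · exact (hc.integrableOn_Icc).mono_set Ioc_subset_Icc_self

/-- Cauchy's formula on |w| = r, with |w - z| ≥ r - R; the factor tends to 1/(1 - R) as r ↑ 1. -/
theorem norm_le_of_circleMean_le {f : ℂ → ℂ} (hf : DifferentiableOn ℂ f unitDisc) {r R K : ℝ}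
    (hr1 : r < 1) (hR : R < r) (hK : 0 ≤ K) (h : circleMean 1 f r ≤ ENNReal.ofReal K) {z : ℂ}
    (hz : ‖z‖ ≤ R) : ‖f z‖ ≤ r / (r - R) * K := by
  have hr0 : 0 < r := (norm_nonneg z).trans_lt (hz.trans_lt hR)
  have hsub : Metric.closedBall (0 : ℂ) r ⊆ unitDisc := Metric.closedBall_subset_ball hr1
  have hd : DiffContOnCl ℂ f (Metric.ball 0 r) := by
    refine (hf.mono ?_).diffContOnCl
    exact closure_ball (0 : ℂ) hr0.ne' ▸ hsub
  have hmem : z ∈ Metric.ball (0 : ℂ) r := by simpa using hz.trans_lt hR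
  have hC := hd.circleIntegral_sub_inv_smul hmem
  have hcont := continuous_comp_circle hf.continuousOn hr0.le hr1
  have h1 : ‖∮ w in C(0, r), (w - z)⁻¹ • f w‖ ≤
      ∫ θ in (0 : ℝ)..(2 * Real.pi), r / (r - R) * ‖f (r * Complex.exp (θ * Complex.I))‖ := by
    rw [circleIntegral]
    refine intervalIntegral.norm_integral_le_of_norm_le (by positivity) ?_
      ((hcont.norm.const_mul _ ).intervalIntegrable _ _)
    refine Eventually.of_forall fun θ _ => ?_
    have e : circleMap 0 r θ = r * Complex.exp (θ * Complex.I) := by simp [circleMap]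
    rw [deriv_circleMap, norm_smul, norm_smul, norm_mul, e, Complex.norm_I, mul_one,
      norm_mul_exp_mul_I hr0.le, norm_inv, ← mul_assoc, ← div_eq_mul_inv]
    refine mul_le_mul_of_nonneg_right ?_ (norm_nonneg _)
    refine div_le_div_of_nonneg_left hr0.le (by linarith) ?_
    have := norm_sub_norm_le ((r : ℂ) * Complex.exp (θ * Complex.I)) z
    rw [norm_mul_exp_mul_I hr0.le] at this
    linarith
  rw [hC, intervalIntegral.integral_const_mul, norm_smul] at h1
  have h2 := integral_norm_le_of_circleMean_le hf.continuousOn hr0.le hr1 hK h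
  have h3 : ‖(2 * Real.pi * Complex.I : ℂ)‖ = 2 * Real.pi := by
    simp [abs_of_pos Real.pi_pos]
  rw [h3] at h1
  have h4 : 2 * Real.pi * ‖f z‖ ≤ r / (r - R) * (2 * Real.pi * K) :=
    h1.trans (mul_le_mul_of_nonneg_left h2 (div_nonneg hr0.le (by linarith)))
  have h5 : 0 < 2 * Real.pi := by positivity
  nlinarith

theorem circleMean_mono {f g : ℂ → ℂ} {r : ℝ} (hr : 0 ≤ r) (p : ℝ≥0∞)
    (h : ∀ z : ℂ, ‖z‖ = r → ‖f z‖ ≤ ‖g z‖) : circleMean p f r ≤ circleMean p g r :=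
  eLpNorm_mono fun θ => h _ (norm_mul_exp_mul_I hr θ)

theorem circleMean_le_of_norm_le {f : ℂ → ℂ} {r K : ℝ} (hr : 0 ≤ r) (p : ℝ≥0∞)
    (h : ∀ z : ℂ, ‖z‖ = r → ‖f z‖ ≤ K) : circleMean p f r ≤ ENNReal.ofReal K := by
  have := eLpNorm_le_of_ae_bound (p := p) (μ := angleMeasure)
    (Eventually.of_forall fun θ : ℝ => h _ (norm_mul_exp_mul_I hr θ))
  simpa [circleMean] using this

theorem eventually_mem_Ioo_one {R : ℝ} (hR : R < 1) : ∀ᶠ r in 𝓝[<] (1 : ℝ), r ∈ Ioo R 1 :=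
  Ioo_mem_nhdsLT hR

theorem hardyNorm_le_one_of_norm_le {f : ℂ → ℂ} (h : ∀ z ∈ unitDisc, ‖f z‖ ≤ 1) (p : ℝ≥0∞) :
    hardyNorm p f ≤ 1 := by
  refine limsup_le_of_le (h := ?_)
  filter_upwards [eventually_mem_Ioo_one (one_pos (α := ℝ))] with r hr
  have := circleMean_le_of_norm_le (f := f) (K := 1) hr.1.le p
    fun z hz => h z (mem_unitDisc.2 (hz ▸ hr.2))
  simpa using this

theorem eventually_circleMean_one_le {f : ℂ → ℂ} (hf : ContinuousOn f unitDisc) {p : ℝ≥0∞}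
    (hp : 1 ≤ p) (h : hardyNorm p f ≤ 1) {η : ℝ} (hη : 0 < η) :
    ∀ᶠ r in 𝓝[<] (1 : ℝ), circleMean 1 f r ≤ ENNReal.ofReal (1 + η) := by
  have h1 : limsup (circleMean p f) (𝓝[<] (1 : ℝ)) < ENNReal.ofReal (1 + η) := by
    refine lt_of_le_of_lt h ?_
    rw [← ENNReal.ofReal_one]
    exact (ENNReal.ofReal_lt_ofReal_iff (by linarith)).2 (by linarith)
  filter_upwards [eventually_lt_of_limsup_lt h1, eventually_mem_Ioo_one (one_pos (α := ℝ))]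
    with r hr hr1
  exact (circleMean_one_le hf hr1.1.le hr1.2 hp).trans hr.le

/-- A function with bounded means is dominated by the Blaschke product of its zeros. -/
theorem norm_le_prod_blaschkeFactor {f : ℂ → ℂ} (hf : DifferentiableOn ℂ f unitDisc) {K : ℝ}
    (hK : 0 ≤ K)
    (h : ∀ η : ℝ, 0 < η → ∀ᶠ r in 𝓝[<] (1 : ℝ), circleMean 1 f r ≤ ENNReal.ofReal (K + η))
    (S : Finset ℂ) (hS : ∀ a ∈ S, a ∈ unitDisc ∧ f a = 0) {R : ℝ} (hR : R < 1) {z : ℂ}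
    (hz : ‖z‖ ≤ R) : ‖f z‖ ≤ K / (1 - R) * ∏ a ∈ S, ‖blaschkeFactor a z‖ := by
  obtain ⟨F, hF, hm⟩ := exists_eq_prod_blaschkeFactor_mul S hf hS
  rw [hm z (mem_unitDisc.2 (hz.trans_lt hR)), norm_mul, norm_prod, mul_comm]
  refine mul_le_mul_of_nonneg_right ?_ (Finset.prod_nonneg fun _ _ => norm_nonneg _)
  -- On circles close to the boundary every Blaschke factor has modulus at least 1 - η, so passing
  -- from f to F costs only (1 - η)^{-|S|} in the mean. Afterwards r ↑ 1 and then η ↓ 0.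
  have key : ∀ η ∈ Ioo (0 : ℝ) 1, ∀ᶠ r in 𝓝[<] (1 : ℝ),
      ‖F z‖ ≤ r / (r - R) * ((K + η) / (1 - η) ^ S.card) := by
    intro η hη
    have h1 : ∀ᶠ r in 𝓝[<] (1 : ℝ), ∀ a ∈ S, ∀ w : ℂ, ‖w‖ = r → 1 - η ≤ ‖blaschkeFactor a w‖ :=
      (Finset.eventually_all S).2
        fun a ha => tendsto_norm_blaschkeFactor (mem_unitDisc.1 (hS a ha).1) hη.1
    have hpos : 0 < (1 - η) ^ S.card := pow_pos (by linarith [hη.2]) _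
    filter_upwards [h η hη.1, h1, eventually_mem_Ioo_one (max_lt hR one_pos)] with r hr1 hr2 hr3
    have hr0 : 0 ≤ r := (le_max_right _ _).trans hr3.1.le
    refine norm_le_of_circleMean_le hF hr3.2 ((le_max_left _ _).trans_lt hr3.1)
      (div_nonneg (by linarith [hη.1]) hpos.le) ?_ hz
    have h4 : circleMean 1 F r ≤ circleMean 1 (fun w => (((1 - η) ^ S.card)⁻¹ : ℝ) • f w) r := by
      refine circleMean_mono hr0 _ fun w hw => ?_
      rw [norm_smul, norm_inv, Real.norm_of_nonneg hpos.le, hm w (mem_unitDisc.2 (hw ▸ hr3.2)),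
        norm_mul, norm_prod, ← mul_assoc]
      refine le_mul_of_one_le_left (norm_nonneg _) ?_
      rw [← div_eq_inv_mul, one_le_div hpos, ← Finset.prod_const]
      exact Finset.prod_le_prod (fun _ _ => by linarith [hη.2]) fun a ha => hr2 a ha w hw
    refine h4.trans ?_
    have h5 : circleMean 1 (fun w => (((1 - η) ^ S.card)⁻¹ : ℝ) • f w) r =
        ENNReal.ofReal ((1 - η) ^ S.card)⁻¹ * circleMean 1 f r := by
      rw [circleMean, circleMean, ← Real.enorm_of_nonneg (inv_nonneg.2 hpos.le),
        ← eLpNorm_const_smul]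
      rfl
    rw [h5, div_eq_inv_mul, ENNReal.ofReal_mul (inv_nonneg.2 hpos.le)]
    gcongr
  have key2 : ∀ η ∈ Ioo (0 : ℝ) 1, ‖F z‖ ≤ 1 / (1 - R) * ((K + η) / (1 - η) ^ S.card) := by
    intro η hη
    refine ge_of_tendsto ?_ (key η hη)
    refine Tendsto.mul_const _ ?_
    have : ContinuousAt (fun r : ℝ => r / (r - R)) 1 :=
      continuousAt_id.div (by fun_prop) (by linarith)
    exact this.tendsto.mono_left nhdsWithin_le_nhds
  have hlim : Tendsto (fun η : ℝ => 1 / (1 - R) * ((K + η) / (1 - η) ^ S.card)) (𝓝[>] 0)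
      (𝓝 (K / (1 - R))) := by
    have : ContinuousAt (fun η : ℝ => 1 / (1 - R) * ((K + η) / (1 - η) ^ S.card)) 0 :=
      continuousAt_const.mul (ContinuousAt.div (by fun_prop) (by fun_prop) (by simp))
    convert this.tendsto.mono_left nhdsWithin_le_nhds using 2
    simp [div_eq_inv_mul]
  exact ge_of_tendsto hlim (by filter_upwards [Ioo_mem_nhdsGT one_pos] with η hη using key2 η hη)

/-- Error of a bounded interpolating function. -/
theorem norm_sub_le_prod_blaschkeFactor {g L : ℂ → ℂ} (hg : DifferentiableOn ℂ g unitDisc)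
    {p : ℝ≥0∞} (hp : 1 ≤ p) (hgp : hardyNorm p g ≤ 1) (hL : DifferentiableOn ℂ L unitDisc) {K : ℝ}
    (hK : 0 ≤ K) (hLK : ∀ w ∈ unitDisc, ‖L w‖ ≤ K) (S : Finset ℂ)
    (hS : ∀ a ∈ S, a ∈ unitDisc ∧ L a = g a) {R : ℝ} (hR : R < 1) {z : ℂ} (hz : ‖z‖ ≤ R) :
    ‖g z - L z‖ ≤ (1 + K) / (1 - R) * ∏ a ∈ S, ‖blaschkeFactor a z‖ := by
  refine norm_le_prod_blaschkeFactor (hg.sub hL) (by linarith) (fun η hη => ?_) S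
    (fun a ha => ⟨(hS a ha).1, sub_eq_zero.2 (hS a ha).2.symm⟩) hR hz
  filter_upwards [eventually_circleMean_one_le hg.continuousOn hp hgp hη,
    eventually_mem_Ioo_one (one_pos (α := ℝ))] with r hr hr1
  have h1 : circleMean 1 L r ≤ ENNReal.ofReal K :=
    circleMean_le_of_norm_le hr1.1.le 1 fun w hw => hLK w (mem_unitDisc.2 (hw ▸ hr1.2))
  refine (eLpNorm_sub_le
    (continuous_comp_circle hg.continuousOn hr1.1.le hr1.2).aestronglyMeasurable
    (continuous_comp_circle hL.continuousOn hr1.1.le hr1.2).aestronglyMeasurable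
    le_rfl).trans ?_
  refine (add_le_add hr h1).trans ?_
  rw [← ENNReal.ofReal_add (by linarith) hK]
  exact ENNReal.ofReal_le_ofReal (by linarith)

theorem norm_le_of_hardyNorm_le_one {f : ℂ → ℂ} (hf : DifferentiableOn ℂ f unitDisc) {p : ℝ≥0∞}
    (hp : 1 ≤ p) (h : hardyNorm p f ≤ 1) {R : ℝ} (hR : R < 1) {z : ℂ} (hz : ‖z‖ ≤ R) :
    ‖f z‖ ≤ 1 / (1 - R) := by
  have := norm_le_prod_blaschkeFactor hf zero_le_one
    (fun η hη => eventually_circleMean_one_le hf.continuousOn hp h hη) ∅ (by simp) hR hz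
  simpa using this

end HardyStability
-- Generalized Blaschke products, and g_R as a lower bound for the stability constant.
namespace HardyStability

theorem subset_relClosure {E : Set ℂ} (hE : E ⊆ unitDisc) : E ⊆ relClosure E :=
  fun _ hz => ⟨subset_closure hz, hE hz⟩

/-- Bounds on a relatively open part of `E` extend to its relative closure. -/
theorem norm_le_of_mem_relClosure {E : Set ℂ} {f : ℂ → ℂ} (hf : ContinuousOn f unitDisc)
    {O : Set ℂ} (hO : IsOpen O) {c : ℝ} (h : ∀ z ∈ E ∩ O, ‖f z‖ ≤ c) {z : ℂ}
    (hz : z ∈ relClosure E) (hzO : z ∈ O) : ‖f z‖ ≤ c := by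
  have h1 : z ∈ closure (E ∩ O) := by
    rw [inter_comm]
    exact hO.inter_closure ⟨hzO, hz.1⟩
  have h2 : ContinuousAt (fun z => ‖f z‖) z :=
    (hf.continuousAt (isOpen_unitDisc.mem_nhds hz.2)).norm
  exact (isClosed_Iic (a := c)).mem_of_frequently_of_tendsto
    ((mem_closure_iff_frequently.1 h1).mono h) h2.tendsto

namespace IsWeight

variable {E : Set ℂ} {q : ℂ → ℂ}

theorem norm_le_one (hq : IsWeight E q) {z : ℂ} (hz : z ∈ unitDisc) : ‖q z‖ ≤ 1 :=
  hq.norm_eq_one.1 (mem_image_of_mem _ hz)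

theorem norm_pos (hq : IsWeight E q) {z : ℂ} (hz : z ∈ unitDisc) : 0 < ‖q z‖ :=
  norm_pos_iff.2 (hq.ne_zero z hz)

theorem exists_norm_lt (hq : IsWeight E q) {δ : ℝ} (hδ : 0 < δ) :
    ∃ ρ : ℝ, ρ < 1 ∧ ∀ z ∈ relClosure E, ρ < ‖z‖ → ‖q z‖ < δ := by
  obtain ⟨ρ, hρ, h⟩ := hq.tendsto_zero (δ / 2) (by linarith)
  refine ⟨ρ, hρ, fun z hz hzρ => ?_⟩
  have := norm_le_of_mem_relClosure hq.holomorphic.continuousOn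
    (isOpen_lt continuous_const continuous_norm) (c := δ / 2) (fun w hw => (h w hw.1 hw.2).le) hz hzρ
  linarith

end IsWeight

variable {E : Set ℂ} {q : ℂ → ℂ} {n : ℕ} {Z : Fin n → ℂ}

theorem differentiableOn_genBlaschke (hq : IsWeight E q) (hZ : ∀ j, Z j ∈ unitDisc) :
    DifferentiableOn ℂ (genBlaschke q Z) unitDisc := by
  unfold genBlaschke
  exact (DifferentiableOn.fun_finsetProd
    fun j _ => differentiableOn_blaschkeFactor (mem_unitDisc.1 (hZ j))).mul hq.holomorphic

theorem norm_prod_blaschkeFactor_le_one (hZ : ∀ j, Z j ∈ unitDisc) {z : ℂ} (hz : z ∈ unitDisc) :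
    ∏ j, ‖blaschkeFactor (Z j) z‖ ≤ 1 :=
  Finset.prod_le_one (fun _ _ => norm_nonneg _)
    fun j _ => norm_blaschkeFactor_le_one (mem_unitDisc.1 (hZ j)) (mem_unitDisc.1 hz).le

theorem norm_genBlaschke (z : ℂ) :
    ‖genBlaschke q Z z‖ = (∏ j, ‖blaschkeFactor (Z j) z‖) * ‖q z‖ := by
  rw [genBlaschke, norm_mul, norm_prod]

theorem norm_genBlaschke_le_weight (hZ : ∀ j, Z j ∈ unitDisc) {z : ℂ} (hz : z ∈ unitDisc) :
    ‖genBlaschke q Z z‖ ≤ ‖q z‖ := by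
  rw [norm_genBlaschke]
  exact mul_le_of_le_one_left (norm_nonneg _) (norm_prod_blaschkeFactor_le_one hZ hz)

theorem norm_genBlaschke_le_one (hq : IsWeight E q) (hZ : ∀ j, Z j ∈ unitDisc) {z : ℂ}
    (hz : z ∈ unitDisc) : ‖genBlaschke q Z z‖ ≤ 1 :=
  (norm_genBlaschke_le_weight hZ hz).trans (hq.norm_le_one hz)

theorem bddAbove_norm_genBlaschke (hE : E ⊆ unitDisc) (hq : IsWeight E q)
    (hZ : ∀ j, Z j ∈ unitDisc) : BddAbove ((fun z => ‖genBlaschke q Z z‖) '' E) :=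
  ⟨1, forall_mem_image.2 fun _ hz => norm_genBlaschke_le_one hq hZ (hE hz)⟩

theorem norm_genBlaschke_le_maxOn (hE : E ⊆ unitDisc) (hq : IsWeight E q)
    (hZ : ∀ j, Z j ∈ unitDisc) {z : ℂ} (hz : z ∈ E) : ‖genBlaschke q Z z‖ ≤ maxOn E q Z :=
  le_csSup (bddAbove_norm_genBlaschke hE hq hZ) (mem_image_of_mem _ hz)

theorem maxOn_le (hE : E.Nonempty) {c : ℝ} (h : ∀ z ∈ E, ‖genBlaschke q Z z‖ ≤ c) :
    maxOn E q Z ≤ c :=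
  csSup_le (hE.image _) (forall_mem_image.2 h)

theorem maxOn_le_one (hE : E ⊆ unitDisc) (hne : E.Nonempty) (hq : IsWeight E q)
    (hZ : ∀ j, Z j ∈ unitDisc) : maxOn E q Z ≤ 1 :=
  maxOn_le hne fun _ hz => norm_genBlaschke_le_one hq hZ (hE hz)

theorem maxOn_nonneg : 0 ≤ maxOn E q Z :=
  Real.sSup_nonneg (forall_mem_image.2 fun _ _ => norm_nonneg _)

theorem maxOn_pos (hE : E ⊆ unitDisc) (hinf : E.Infinite) (hq : IsWeight E q)
    (hZ : ∀ j, Z j ∈ unitDisc) : 0 < maxOn E q Z := by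
  obtain ⟨z, hz, hzZ⟩ := hinf.exists_notMem_finite (finite_range Z)
  refine lt_of_lt_of_le ?_ (norm_genBlaschke_le_maxOn hE hq hZ hz)
  rw [norm_genBlaschke]
  refine mul_pos (Finset.prod_pos fun j _ => norm_pos_iff.2 ?_) (hq.norm_pos (hE hz))
  exact blaschkeFactor_ne_zero (mem_unitDisc.1 (hZ j)) (mem_unitDisc.1 (hE hz)).le
    fun h => hzZ ⟨j, h.symm⟩

/-- Near the circle the weight is below 1/2; on the rest of E a single Blaschke factor is already
uniformly below 1. Consequently powers of one product reach any ε, which makes the supremum defining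
g_R range over a nonempty set. -/
theorem maxOn_lt_one (hne : E.Nonempty) (hE : E ⊆ unitDisc) (hq : IsWeight E q)
    (hZ : ∀ j, Z j ∈ unitDisc) (hn : 1 ≤ n) : maxOn E q Z < 1 := by
  obtain ⟨ρ, hρ, h⟩ := hq.exists_norm_lt (δ := 1 / 2) (by norm_num)
  let j₀ : Fin n := ⟨0, hn⟩
  obtain ⟨c, hc0, hc1, hc⟩ := exists_norm_blaschkeFactor_le (ρ := max ρ ‖Z j₀‖)
    (max_lt hρ (mem_unitDisc.1 (hZ j₀)))
  refine (maxOn_le hne (c := max c (1 / 2)) fun z hz => ?_).trans_lt (max_lt hc1 (by norm_num))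
  rcases lt_or_ge ρ ‖z‖ with h1 | h1
  · exact le_max_of_le_right ((norm_genBlaschke_le_weight hZ (hE hz)).trans
      (h z (subset_relClosure hE hz) h1).le)
  · refine le_max_of_le_left ?_
    rw [norm_genBlaschke, ← Finset.mul_prod_erase _ _ (Finset.mem_univ j₀), mul_assoc]
    refine (mul_le_of_le_one_right (norm_nonneg _) ?_).trans
      (hc _ _ (le_max_right _ _) (h1.trans (le_max_left _ _)))
    refine mul_le_one₀ (Finset.prod_le_one (fun _ _ => norm_nonneg _) fun j _ => ?_)
      (norm_nonneg _) (hq.norm_le_one (hE hz))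
    exact norm_blaschkeFactor_le_one (mem_unitDisc.1 (hZ j)) (mem_unitDisc.1 (hE hz)).le

/-- A generalized Blaschke product takes values on `|z| ≤ R` at least as large as its
geometric mean on `|z| = R`. -/
theorem exists_le_norm_genBlaschke (hq : IsWeight E q) (hZ : ∀ j, Z j ∈ unitDisc) {R : ℝ}
    (hR0 : 0 < R) (hR1 : R < 1) :
    ∃ z : ℂ, ‖z‖ ≤ R ∧ ‖q 0‖ * ∏ j, max R ‖Z j‖ ≤ ‖genBlaschke q Z z‖ := by
  classical
  -- For |a| < R this is the Blaschke factor of the unit disc divided by that of the disc |z| < R.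
  -- It has the same modulus on |z| = R, no zero inside, and value R at 0.
  let c : ℂ → ℂ → ℂ := fun a z =>
    if ‖a‖ < R then ((R : ℂ) ^ 2 - conj a * z) / (R * (1 - conj a * z)) else blaschkeFactor a z
  have hRc : (R : ℂ) ≠ 0 := by exact_mod_cast hR0.ne'
  have hc : ∀ a ∈ unitDisc, DifferentiableOn ℂ (c a) unitDisc := by
    intro a ha
    by_cases h : ‖a‖ < R
    · intro z hz
      refine DifferentiableAt.differentiableWithinAt ?_
      have : (R : ℂ) * (1 - conj a * z) ≠ 0 := mul_ne_zero hRc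
        (one_sub_conj_mul_ne_zero (mem_unitDisc.1 ha) (mem_unitDisc.1 hz).le)
      simp only [c, h, if_true]
      fun_prop (disch := assumption)
    · simp only [c, h, if_false]
      exact differentiableOn_blaschkeFactor (mem_unitDisc.1 ha)
  have hc0 : ∀ a, ‖c a 0‖ = max R ‖a‖ := by
    intro a
    by_cases h : ‖a‖ < R
    · have e : c a 0 = R := by simp only [c, h, if_true]; field_simp; ring
      rw [e, max_eq_left h.le, Complex.norm_real, Real.norm_of_nonneg hR0.le]
    · have e : c a 0 = -a := by simp [c, h, blaschkeFactor]
      rw [e, norm_neg, max_eq_right (not_lt.1 h)]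
  have hcR : ∀ a w : ℂ, ‖w‖ = R → ‖c a w‖ = ‖blaschkeFactor a w‖ := by
    intro a w hw
    by_cases h : ‖a‖ < R
    · have e : (R : ℂ) ^ 2 - conj a * w = w * conj (w - a) := by
        rw [map_sub, mul_sub, Complex.mul_conj, Complex.normSq_eq_norm_sq, hw]
        push_cast
        ring
      simp only [c, h, if_true, blaschkeFactor]
      rw [e, norm_div, norm_mul, norm_mul, norm_div, RCLike.norm_conj, hw, Complex.norm_real,
        Real.norm_of_nonneg hR0.le, mul_div_mul_left _ _ hR0.ne']
    · simp only [c, h, if_false]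
  let H : ℂ → ℂ := fun z => (∏ j, c (Z j) z) * q z
  have hH : DifferentiableOn ℂ H unitDisc :=
    (DifferentiableOn.fun_finsetProd fun j _ => hc _ (hZ j)).mul hq.holomorphic
  have hd : DiffContOnCl ℂ H (Metric.ball 0 R) := by
    refine (hH.mono ?_).diffContOnCl
    exact closure_ball (0 : ℂ) hR0.ne' ▸ Metric.closedBall_subset_ball hR1
  obtain ⟨w, hw, hmax⟩ := Complex.exists_mem_frontier_isMaxOn_norm Metric.isBounded_ball
    ⟨0, Metric.mem_ball_self hR0⟩ hd
  rw [frontier_ball _ hR0.ne', mem_sphere_zero_iff_norm] at hw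
  refine ⟨w, hw.le, ?_⟩
  have h := hmax (subset_closure (Metric.mem_ball_self hR0))
  simp only [mem_ofPred_eq, Function.comp, H, norm_mul, norm_prod, hc0, hcR _ _ hw] at h
  rw [norm_genBlaschke, mul_comm]
  exact h

theorem bddAbove_stabilityConst {p : ℝ≥0∞} (hp : 1 ≤ p) {ε R : ℝ} (hR : R < 1) :
    BddAbove {x : ℝ | ∃ g : ℂ → ℂ, DifferentiableOn ℂ g unitDisc ∧ hardyNorm p g ≤ 1 ∧
      (∀ ζ ∈ E, ‖g ζ‖ ≤ ε) ∧ ∃ z : ℂ, ‖z‖ ≤ R ∧ x = ‖g z‖} := by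
  refine ⟨1 / (1 - R), ?_⟩
  rintro x ⟨g, hg, hgp, -, z, hz, rfl⟩
  exact norm_le_of_hardyNorm_le_one hg hp hgp hR hz

theorem le_stabilityConst {p : ℝ≥0∞} (hp : 1 ≤ p) {ε R : ℝ} (hR : R < 1) {g : ℂ → ℂ}
    (hg : DifferentiableOn ℂ g unitDisc) (hgp : hardyNorm p g ≤ 1) (hgE : ∀ ζ ∈ E, ‖g ζ‖ ≤ ε)
    {z : ℂ} (hz : ‖z‖ ≤ R) : ‖g z‖ ≤ stabilityConst E p ε R :=
  le_csSup (bddAbove_stabilityConst hp hR) ⟨g, hg, hgp, hgE, z, hz, rfl⟩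

theorem stabilityConst_le {p : ℝ≥0∞} {ε R : ℝ} {c : ℝ} (hc : 0 ≤ c)
    (h : ∀ g : ℂ → ℂ, DifferentiableOn ℂ g unitDisc → hardyNorm p g ≤ 1 →
      (∀ ζ ∈ E, ‖g ζ‖ ≤ ε) → ∀ z : ℂ, ‖z‖ ≤ R → ‖g z‖ ≤ c) :
    stabilityConst E p ε R ≤ c := by
  refine Real.sSup_le ?_ hc
  rintro x ⟨g, hg, hgp, hgE, z, hz, rfl⟩
  exact h g hg hgp hgE z hz

/-- The base of the powers in the definition of `gFun`. -/
theorem geometricMean_mem {R : ℝ} (hR0 : 0 < R) (hR1 : R < 1) (hq : IsWeight E q)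
    (hZ : ∀ j, Z j ∈ unitDisc) : ‖q 0‖ * ∏ j, max R ‖Z j‖ ∈ Ioc (0 : ℝ) 1 := by
  have h0 : (0 : ℂ) ∈ unitDisc := by simp [unitDisc]
  refine ⟨mul_pos (hq.norm_pos h0) (Finset.prod_pos fun j _ => hR0.trans_le (le_max_left _ _)),
    mul_le_one₀ (hq.norm_le_one h0)
      (Finset.prod_nonneg fun j _ => hR0.le.trans (le_max_left _ _)) ?_⟩
  exact Finset.prod_le_one (fun j _ => hR0.le.trans (le_max_left _ _))
    fun j _ => max_le hR1.le (mem_unitDisc.1 (hZ j)).le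

theorem bddAbove_gFun {R : ℝ} (hR0 : 0 < R) (hR1 : R < 1) (hq : IsWeight E q) (ε : ℝ) :
    BddAbove {x : ℝ | ∃ (s n : ℕ) (Z : Fin n → ℂ), 1 ≤ s ∧ 1 ≤ n ∧ (∀ j, Z j ∈ relClosure E) ∧
      maxOn E q Z ^ s ≤ ε ∧ x = (‖q 0‖ * ∏ j, max R ‖Z j‖) ^ s} := by
  refine ⟨1, ?_⟩
  rintro x ⟨s, n, Z, -, -, hZ, -, rfl⟩
  have := geometricMean_mem hR0 hR1 hq fun j => (hZ j).2
  exact pow_le_one₀ this.1.le this.2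

theorem le_gFun {R : ℝ} (hR0 : 0 < R) (hR1 : R < 1) (hq : IsWeight E q) {ε : ℝ} {s : ℕ}
    (hs : 1 ≤ s) (hn : 1 ≤ n) (hZ : ∀ j, Z j ∈ relClosure E) (h : maxOn E q Z ^ s ≤ ε) :
    (‖q 0‖ * ∏ j, max R ‖Z j‖) ^ s ≤ gFun E q R ε :=
  le_csSup (bddAbove_gFun hR0 hR1 hq ε) ⟨s, n, Z, hs, hn, hZ, h, rfl⟩

theorem gFun_le {R ε c : ℝ} (hc : 0 ≤ c)
    (h : ∀ (s n : ℕ) (Z : Fin n → ℂ), 1 ≤ s → 1 ≤ n → (∀ j, Z j ∈ relClosure E) →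
      maxOn E q Z ^ s ≤ ε → (‖q 0‖ * ∏ j, max R ‖Z j‖) ^ s ≤ c) : gFun E q R ε ≤ c := by
  refine Real.sSup_le ?_ hc
  rintro x ⟨s, n, Z, hs, hn, hZ, hM, rfl⟩
  exact h s n Z hs hn hZ hM

theorem gFun_pos {R : ℝ} (hR0 : 0 < R) (hR1 : R < 1) (hE : E ⊆ unitDisc) (hne : E.Nonempty)
    (hq : IsWeight E q) {ε : ℝ} (hε : 0 < ε) : 0 < gFun E q R ε := by
  obtain ⟨z, hz⟩ := hne
  let Z : Fin 1 → ℂ := fun _ => z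
  have hZ : ∀ j, Z j ∈ relClosure E := fun _ => subset_relClosure hE hz
  have hlt := maxOn_lt_one ⟨z, hz⟩ hE hq (fun j => (hZ j).2) le_rfl
  obtain ⟨k, hk⟩ := exists_pow_lt_of_lt_one hε hlt
  have hk2 : maxOn E q Z ^ (k + 1) ≤ ε :=
    (pow_le_pow_of_le_one maxOn_nonneg hlt.le k.le_succ).trans hk.le
  exact (pow_pos (geometricMean_mem hR0 hR1 hq fun j => (hZ j).2).1 _).trans_le
    (le_gFun hR0 hR1 hq (Nat.le_add_left 1 k) le_rfl hZ hk2)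

theorem gFun_mono {R : ℝ} (hR0 : 0 < R) (hR1 : R < 1) (hE : E ⊆ unitDisc) (hne : E.Nonempty)
    (hq : IsWeight E q) {ε δ : ℝ} (hε : 0 < ε) (h : ε ≤ δ) : gFun E q R ε ≤ gFun E q R δ :=
  gFun_le (gFun_pos hR0 hR1 hE hne hq (hε.trans_le h)).le
    fun _ _ _ hs hn hZ hM => le_gFun hR0 hR1 hq hs hn hZ (hM.trans h)

/-- Raising an admissible power s to s·m with m = ⌊κ⌋ + 1 > κ replaces ε by ε^m ≤ ε^κ. -/
theorem gFun_pow_le {R : ℝ} (hR0 : 0 < R) (hR1 : R < 1) (hE : E ⊆ unitDisc) (hne : E.Nonempty)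
    (hq : IsWeight E q) {ε : ℝ} (hε : ε ∈ Ioc (0 : ℝ) 1) (κ : ℝ) :
    gFun E q R ε ^ (⌊κ⌋₊ + 1) ≤ gFun E q R (ε ^ κ) := by
  set m := ⌊κ⌋₊ + 1 with hm
  have hpos := gFun_pos hR0 hR1 hE hne hq (Real.rpow_pos_of_pos hε.1 κ)
  -- Stated with the m-th root so that it can be checked on each competitor in the supremum.
  have h : gFun E q R ε ≤ gFun E q R (ε ^ κ) ^ ((m : ℝ)⁻¹) := by
    refine gFun_le (Real.rpow_nonneg hpos.le _) fun s n Z hs hn hZ hM => ?_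
    have hx := (geometricMean_mem hR0 hR1 hq fun j => (hZ j).2).1
    rw [Real.le_rpow_inv_iff_of_pos (pow_nonneg hx.le _) hpos.le (by positivity),
      Real.rpow_natCast, ← pow_mul]
    refine le_gFun hR0 hR1 hq (Nat.mul_pos hs (Nat.succ_pos _)) hn hZ ?_
    rw [pow_mul]
    refine (pow_le_pow_left₀ (pow_nonneg maxOn_nonneg _) hM m).trans ?_
    rw [← Real.rpow_natCast]
    refine Real.rpow_le_rpow_of_exponent_ge hε.1 hε.2 ?_
    rw [hm]
    push_cast
    exact (Nat.lt_floor_add_one κ).le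
  rwa [Real.le_rpow_inv_iff_of_pos (gFun_pos hR0 hR1 hE hne hq hε.1).le hpos.le (by positivity),
    Real.rpow_natCast] at h

/-- This is `gFun_pow_le` at ε^κ with exponent 1/κ, followed by a root. -/
theorem gFun_rpow_le {R : ℝ} (hR0 : 0 < R) (hR1 : R < 1) (hE : E ⊆ unitDisc) (hne : E.Nonempty)
    (hq : IsWeight E q) {ε : ℝ} (hε : ε ∈ Ioc (0 : ℝ) 1) {κ : ℝ} (hκ : 0 < κ) :
    gFun E q R (ε ^ κ) ≤ gFun E q R ε ^ (1 / ((⌊1 / κ⌋₊ : ℝ) + 1)) := by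
  have hεκ : ε ^ κ ∈ Ioc (0 : ℝ) 1 :=
    ⟨Real.rpow_pos_of_pos hε.1 _, Real.rpow_le_one hε.1.le hε.2 hκ.le⟩
  have h := gFun_pow_le hR0 hR1 hE hne hq hεκ (1 / κ)
  rw [← Real.rpow_mul hε.1.le, mul_one_div_cancel hκ.ne', Real.rpow_one] at h
  rw [one_div, Real.le_rpow_inv_iff_of_pos (gFun_pos hR0 hR1 hE hne hq hεκ.1).le
    (gFun_pos hR0 hR1 hE hne hq hε.1).le (by positivity)]
  exact_mod_cast h

/-- The powers of generalized Blaschke products are admissible in `stabilityConst`. -/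
theorem gFun_le_stabilityConst {R : ℝ} (hR0 : 0 < R) (hR1 : R < 1) (hE : E ⊆ unitDisc)
    (hq : IsWeight E q) {p : ℝ≥0∞} (hp : 1 ≤ p) {ε : ℝ} (hε : 0 ≤ ε) :
    gFun E q R ε ≤ stabilityConst E p ε R := by
  have h0 : 0 ≤ stabilityConst E p ε R := by
    have := le_stabilityConst (E := E) (ε := ε) hp hR1 (g := fun _ => 0)
      (differentiableOn_const _) (hardyNorm_le_one_of_norm_le (by simp) p) (fun _ _ => by simpa)
      (z := 0) (by simpa using hR0.le)
    simpa using this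
  refine gFun_le h0 fun s n Z hs hn hZ hM => ?_
  have hZ' : ∀ j, Z j ∈ unitDisc := fun j => (hZ j).2
  obtain ⟨z, hz, hle⟩ := exists_le_norm_genBlaschke hq hZ' hR0 hR1
  refine (pow_le_pow_left₀ (geometricMean_mem hR0 hR1 hq hZ').1.le hle s).trans ?_
  rw [← norm_pow]
  refine le_stabilityConst hp hR1 (g := fun z => genBlaschke q Z z ^ s)
    ((differentiableOn_genBlaschke hq hZ').pow s)
    (hardyNorm_le_one_of_norm_le (fun w hw => ?_) p) (fun ζ hζ => ?_) hz
  · rw [norm_pow]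
    exact pow_le_one₀ (norm_nonneg _) (norm_genBlaschke_le_one hq hZ' hw)
  · rw [norm_pow]
    exact (pow_le_pow_left₀ (norm_nonneg _)
      (norm_genBlaschke_le_maxOn hE hq hZ' hζ) s).trans hM

end HardyStability
-- Extremal tuples for V and the behaviour of M_n.
namespace HardyStability

variable {E : Set ℂ} {q : ℂ → ℂ} {n : ℕ}

theorem vandermonde_nonneg (q : ℂ → ℂ) (Z : Fin n → ℂ) : 0 ≤ vandermonde q Z :=
  Finset.prod_nonneg fun _ _ => norm_nonneg _

/-- The square is a full double product with no reference to the order of the indices, so any point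
may be treated as the last one. -/
theorem vandermonde_sq (q : ℂ → ℂ) (Z : Fin n → ℂ) : vandermonde q Z ^ 2 =
    ∏ j, ∏ i, if i = j then ‖q (Z j)‖ ^ 2 else ‖blaschkeFactor (Z i) (Z j)‖ := by
  have h1 : ∀ j : Fin n, (∏ i, if i = j then ‖q (Z j)‖ ^ 2 else ‖blaschkeFactor (Z i) (Z j)‖) =
      ‖q (Z j)‖ ^ 2 * ((∏ i ∈ Finset.Iio j, ‖blaschkeFactor (Z i) (Z j)‖) *
        ∏ i ∈ Finset.Ioi j, ‖blaschkeFactor (Z i) (Z j)‖) := by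
    intro j
    rw [← Finset.mul_prod_erase _ _ (Finset.mem_univ j), if_pos rfl]
    congr 1
    have hdisj : Disjoint (Finset.Iio j) (Finset.Ioi j) := by
      rw [Finset.disjoint_left]
      intro i hi hi'
      exact lt_asymm (Finset.mem_Iio.1 hi) (Finset.mem_Ioi.1 hi')
    rw [← Finset.prod_union hdisj]
    refine Finset.prod_congr ?_ fun i hi => if_neg ?_
    · ext i
      simp [lt_or_lt_iff_ne]
    · rcases Finset.mem_union.1 hi with h | h
      · exact (Finset.mem_Iio.1 h).ne
      · exact (Finset.mem_Ioi.1 h).ne'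
  have h2 : ∏ j, ∏ i ∈ Finset.Ioi j, ‖blaschkeFactor (Z i) (Z j)‖ =
      ∏ j, ∏ i ∈ Finset.Iio j, ‖blaschkeFactor (Z i) (Z j)‖ := by
    rw [Finset.prod_comm' (t' := Finset.univ) (s' := fun i => Finset.Iio i) (by simp)]
    exact Finset.prod_congr rfl fun i _ => Finset.prod_congr rfl fun j _ =>
      norm_blaschkeFactor_comm _ _
  simp only [h1, Finset.prod_mul_distrib, h2, vandermonde, norm_mul, norm_prod, Finset.prod_pow]
  ring

/-- Splitting off one point of the tuple. -/
theorem vandermonde_eq_mul (q : ℂ → ℂ) (Z : Fin (n + 1) → ℂ) (p : Fin (n + 1)) :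
    vandermonde q Z =
      vandermonde q (Z ∘ p.succAbove) * ‖genBlaschke q (Z ∘ p.succAbove) (Z p)‖ := by
  refine (sq_eq_sq₀ (vandermonde_nonneg _ _)
    (mul_nonneg (vandermonde_nonneg _ _) (norm_nonneg _))).1 ?_
  rw [mul_pow, vandermonde_sq, vandermonde_sq, Fin.prod_univ_succAbove _ p]
  simp_rw [Fin.prod_univ_succAbove _ p]
  simp only [if_true, Fin.succAbove_ne, (Fin.succAbove_ne p _).symm, if_false,
    Finset.prod_mul_distrib, Fin.succAbove_right_inj, Function.comp, norm_genBlaschke,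
    norm_blaschkeFactor_comm (Z p)]
  ring

theorem vandermonde_cons (q : ℂ → ℂ) (z : ℂ) (Z : Fin n → ℂ) :
    vandermonde q (Fin.cons z Z : Fin (n + 1) → ℂ) = vandermonde q Z * ‖genBlaschke q Z z‖ := by
  have h : (Fin.cons z Z : Fin (n + 1) → ℂ) ∘ Fin.succAbove 0 = Z := by
    ext i
    simp
  rw [vandermonde_eq_mul q _ 0, h, Fin.cons_zero]

theorem norm_vandermonde_factor_le (Z : Fin n → ℂ) (hZ : ∀ j, Z j ∈ unitDisc) (j : Fin n) :
    ‖(∏ i ∈ Finset.Iio j, blaschkeFactor (Z i) (Z j)) * q (Z j)‖ ≤ ‖q (Z j)‖ := by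
  rw [norm_mul, norm_prod]
  exact mul_le_of_le_one_left (norm_nonneg _) (Finset.prod_le_one (fun _ _ => norm_nonneg _)
    fun i _ => norm_blaschkeFactor_le_one (mem_unitDisc.1 (hZ i)) (mem_unitDisc.1 (hZ j)).le)

/-- All other factors are at most 1. A tuple with a point near the circle therefore has small V,
which is the source of compactness. -/
theorem vandermonde_le_weight (hq : IsWeight E q) {Z : Fin n → ℂ} (hZ : ∀ j, Z j ∈ unitDisc)
    (j : Fin n) : vandermonde q Z ≤ ‖q (Z j)‖ := by
  rw [vandermonde, ← Finset.mul_prod_erase _ _ (Finset.mem_univ j)]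
  refine (mul_le_of_le_one_right (norm_nonneg _) ?_).trans (norm_vandermonde_factor_le Z hZ j)
  exact Finset.prod_le_one (fun _ _ => norm_nonneg _)
    fun i _ => (norm_vandermonde_factor_le Z hZ i).trans (hq.norm_le_one (hZ i))

theorem vandermonde_le_one (hq : IsWeight E q) {Z : Fin n → ℂ} (hZ : ∀ j, Z j ∈ unitDisc) :
    vandermonde q Z ≤ 1 :=
  Finset.prod_le_one (fun _ _ => norm_nonneg _)
    fun i _ => (norm_vandermonde_factor_le Z hZ i).trans (hq.norm_le_one (hZ i))

theorem vandermonde_le_vMax (hq : IsWeight E q) {Z : Fin n → ℂ}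
    (hZ : ∀ j, Z j ∈ relClosure E) : vandermonde q Z ≤ vMax E q n := by
  refine le_csSup ⟨1, ?_⟩ ⟨Z, hZ, rfl⟩
  rintro v ⟨Z', hZ', rfl⟩
  exact vandermonde_le_one hq fun j => (hZ' j).2

theorem vMax_pos (hE : E ⊆ unitDisc) (hinf : E.Infinite) (hq : IsWeight E q) (n : ℕ) :
    0 < vMax E q n := by
  let Z : Fin n → ℂ := fun j => hinf.natEmbedding E j
  have hZE : ∀ j, Z j ∈ E := fun j => (hinf.natEmbedding E j).2
  refine lt_of_lt_of_le ?_ (vandermonde_le_vMax hq fun j => subset_relClosure hE (hZE j))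
  refine Finset.prod_pos fun j _ => norm_pos_iff.2 (mul_ne_zero ?_ (hq.ne_zero _ (hE (hZE j))))
  refine Finset.prod_ne_zero_iff.2 fun i hi => blaschkeFactor_ne_zero
    (mem_unitDisc.1 (hE (hZE i))) (mem_unitDisc.1 (hE (hZE j))).le fun h => ?_
  have h1 := (hinf.natEmbedding E).injective (Subtype.ext h)
  exact (Finset.mem_Iio.1 hi).ne' (Fin.ext h1)

theorem continuousOn_blaschkeFactor_comp {X : Type*} [TopologicalSpace X] {s : Set X}
    {f g : X → ℂ} (hf : ContinuousOn f s) (hg : ContinuousOn g s) (hf1 : MapsTo f s unitDisc)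
    (hg1 : MapsTo g s unitDisc) : ContinuousOn (fun x => blaschkeFactor (f x) (g x)) s := by
  unfold blaschkeFactor
  refine (hg.sub hf).div (continuousOn_const.sub
    ((Complex.continuous_conj.comp_continuousOn hf).mul hg)) fun x hx => ?_
  exact one_sub_conj_mul_ne_zero (mem_unitDisc.1 (hf1 hx)) (mem_unitDisc.1 (hg1 hx)).le

theorem continuousOn_vandermonde (hq : IsWeight E q) :
    ContinuousOn (fun Z : Fin n → ℂ => vandermonde q Z) (univ.pi fun _ => unitDisc) := by
  have hc : ∀ j : Fin n, ContinuousOn (fun Z : Fin n → ℂ => Z j) (univ.pi fun _ => unitDisc) :=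
    fun j => (continuous_apply j).continuousOn
  have hm : ∀ j : Fin n, MapsTo (fun Z : Fin n → ℂ => Z j) (univ.pi fun _ => unitDisc) unitDisc :=
    fun j Z hZ => hZ j (mem_univ j)
  refine continuousOn_finsetProd _ fun j _ => ContinuousOn.norm (ContinuousOn.mul
    (continuousOn_finsetProd _ fun i _ => ?_)
    (hq.holomorphic.continuousOn.comp (hc j) (hm j)))
  exact continuousOn_blaschkeFactor_comp (hc i) (hc j) (hm i) (hm j)

theorem isCompact_closure_inter_closedBall (E : Set ℂ) (ρ : ℝ) :
    IsCompact (closure E ∩ Metric.closedBall (0 : ℂ) ρ) :=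
  (isCompact_closedBall _ _).inter_left isClosed_closure

/-- Tuples with a large value of `V` lie in a fixed compact part of the disc. -/
theorem exists_compact_of_le_vandermonde (hq : IsWeight E q) {δ : ℝ} (hδ : 0 < δ) :
    ∃ ρ : ℝ, ρ < 1 ∧ ∀ (n : ℕ) (Z : Fin n → ℂ), (∀ j, Z j ∈ relClosure E) →
      δ ≤ vandermonde q Z → Z ∈ univ.pi fun _ => closure E ∩ Metric.closedBall (0 : ℂ) ρ := by
  obtain ⟨ρ, hρ, h⟩ := hq.exists_norm_lt hδ
  refine ⟨ρ, hρ, fun n Z hZ hV j _ => ⟨(hZ j).1, ?_⟩⟩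
  rw [mem_closedBall_zero_iff]
  by_contra! hlt
  exact absurd (hV.trans (vandermonde_le_weight hq (fun j => (hZ j).2) j)) (not_le.2 (h _ (hZ j) hlt))

theorem exists_vandermonde_eq_vMax (hE : E ⊆ unitDisc) (hinf : E.Infinite) (hq : IsWeight E q)
    (n : ℕ) : ∃ Z : Fin n → ℂ, (∀ j, Z j ∈ relClosure E) ∧ vandermonde q Z = vMax E q n := by
  have hpos := vMax_pos hE hinf hq n
  -- The relative closure need not be compact, but tuples with V ≥ V_n/2 stay in a compact set, and
  -- there are some.
  obtain ⟨ρ, hρ, hK⟩ := exists_compact_of_le_vandermonde hq (half_pos hpos)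
  have hcomp : IsCompact (univ.pi fun _ : Fin n => closure E ∩ Metric.closedBall (0 : ℂ) ρ) :=
    isCompact_univ_pi fun _ => isCompact_closure_inter_closedBall E ρ
  have hsub : ∀ Z ∈ univ.pi fun _ : Fin n => closure E ∩ Metric.closedBall (0 : ℂ) ρ,
      ∀ j, Z j ∈ relClosure E := fun Z hZ j =>
    ⟨(hZ j (mem_univ j)).1, Metric.closedBall_subset_ball hρ (hZ j (mem_univ j)).2⟩
  have hne : {v : ℝ | ∃ Z : Fin n → ℂ, (∀ j, Z j ∈ relClosure E) ∧ v = vandermonde q Z}.Nonempty :=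
    ⟨_, fun _ => hinf.nonempty.some, fun _ => subset_relClosure hE hinf.nonempty.some_mem, rfl⟩
  obtain ⟨v, ⟨Z₀, hZ₀, rfl⟩, hlt⟩ := exists_lt_of_lt_csSup hne (half_lt_self hpos)
  obtain ⟨Z₁, hZ₁, hmax⟩ := hcomp.exists_isMaxOn ⟨Z₀, hK n Z₀ hZ₀ hlt.le⟩
    ((continuousOn_vandermonde hq).mono fun Z hZ j _ => (hsub Z hZ j).2)
  refine ⟨Z₁, hsub Z₁ hZ₁, le_antisymm (vandermonde_le_vMax hq (hsub Z₁ hZ₁)) ?_⟩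
  refine csSup_le hne ?_
  rintro v ⟨Z, hZ, rfl⟩
  rcases le_or_gt (vMax E q n / 2) (vandermonde q Z) with h | h
  · exact hmax (hK n Z hZ h)
  · exact h.le.trans (hlt.le.trans (hmax (hK n Z₀ hZ₀ hlt.le)))

/-- A supremum of functions continuous in Z; lower semicontinuity is enough for a minimum over the
compact set of extremal tuples. -/
theorem lowerSemicontinuousOn_maxOn (hE : E ⊆ unitDisc) (hne : E.Nonempty) (hq : IsWeight E q) :
    LowerSemicontinuousOn (fun Z : Fin n → ℂ => maxOn E q Z) (univ.pi fun _ => unitDisc) := by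
  intro Z hZ y hy
  obtain ⟨_, ⟨z, hz, rfl⟩, hlt⟩ := exists_lt_of_lt_csSup (hne.image _) hy
  have hc : ContinuousOn (fun Z : Fin n → ℂ => ‖genBlaschke q Z z‖) (univ.pi fun _ => unitDisc) :=
    ContinuousOn.norm (ContinuousOn.mul (continuousOn_finsetProd _ fun j _ =>
      continuousOn_blaschkeFactor_comp (continuous_apply j).continuousOn continuousOn_const
        (fun Z hZ => hZ j (mem_univ j)) fun _ _ => hE hz) continuousOn_const)
  filter_upwards [(hc Z hZ).eventually (lt_mem_nhds hlt), self_mem_nhdsWithin] with Z' h1 h2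
  exact h1.trans_le (norm_genBlaschke_le_maxOn hE hq (fun j => h2 j (mem_univ j)) hz)

theorem mMin_le (Z : Fin n → ℂ) (hZ : ∀ j, Z j ∈ relClosure E)
    (hV : vandermonde q Z = vMax E q n) : mMin E q n ≤ maxOn E q Z := by
  refine csInf_le ⟨0, ?_⟩ ⟨Z, hZ, hV, rfl⟩
  rintro m ⟨Z', -, -, rfl⟩
  exact maxOn_nonneg

/-- The infimum in the definition of `mMin` is attained. -/
theorem exists_maxOn_eq_mMin (hE : E ⊆ unitDisc) (hinf : E.Infinite) (hq : IsWeight E q) (n : ℕ) :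
    ∃ Z : Fin n → ℂ, (∀ j, Z j ∈ relClosure E) ∧ vandermonde q Z = vMax E q n ∧
      maxOn E q Z = mMin E q n := by
  obtain ⟨ρ, hρ, hK⟩ := exists_compact_of_le_vandermonde hq (vMax_pos hE hinf hq n)
  let K : Set (Fin n → ℂ) := univ.pi fun _ => closure E ∩ Metric.closedBall (0 : ℂ) ρ
  have hcomp : IsCompact K := isCompact_univ_pi fun _ => isCompact_closure_inter_closedBall E ρ
  have hsub : ∀ Z ∈ K, ∀ j, Z j ∈ relClosure E := fun Z hZ j =>
    ⟨(hZ j (mem_univ j)).1, Metric.closedBall_subset_ball hρ (hZ j (mem_univ j)).2⟩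
  have hsub' : K ⊆ univ.pi fun _ => unitDisc := fun Z hZ j _ => (hsub Z hZ j).2
  have hWc : IsCompact (K ∩ (fun Z => vandermonde q Z) ⁻¹' {vMax E q n}) :=
    hcomp.of_isClosed_subset (((continuousOn_vandermonde hq).mono hsub').preimage_isClosed_of_isClosed
      hcomp.isClosed isClosed_singleton) inter_subset_left
  obtain ⟨Z₀, hZ₀, hV₀⟩ := exists_vandermonde_eq_vMax hE hinf hq n
  obtain ⟨Z, hZ, hmin⟩ := LowerSemicontinuousOn.exists_isMinOn (f := fun Z => maxOn E q Z)
    (s := K ∩ (fun Z => vandermonde q Z) ⁻¹' {vMax E q n})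
    ⟨Z₀, hK n Z₀ hZ₀ hV₀.ge, hV₀⟩ hWc ((lowerSemicontinuousOn_maxOn hE hinf.nonempty hq).mono
      (inter_subset_left.trans hsub'))
  refine ⟨Z, hsub Z hZ.1, hZ.2, le_antisymm ?_ (mMin_le Z (hsub Z hZ.1) hZ.2)⟩
  refine le_csInf ⟨_, Z, hsub Z hZ.1, hZ.2, rfl⟩ ?_
  rintro m ⟨Z', hZ', hV', rfl⟩
  exact hmin ⟨hK n Z' hZ' hV'.ge, hV'⟩

theorem mMin_pos (hE : E ⊆ unitDisc) (hinf : E.Infinite) (hq : IsWeight E q) (n : ℕ) :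
    0 < mMin E q n := by
  obtain ⟨Z, hZ, -, h⟩ := exists_maxOn_eq_mMin hE hinf hq n
  exact h ▸ maxOn_pos hE hinf hq fun j => (hZ j).2

theorem mMin_le_one (hE : E ⊆ unitDisc) (hinf : E.Infinite) (hq : IsWeight E q) (n : ℕ) :
    mMin E q n ≤ 1 := by
  obtain ⟨Z, hZ, -, h⟩ := exists_maxOn_eq_mMin hE hinf hq n
  exact h ▸ maxOn_le_one hE hinf.nonempty hq fun j => (hZ j).2

/-- Adjoin to an extremal tuple realising M_n an arbitrary point of E and take the supremum over
that point. -/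
theorem vMax_mul_mMin_le (hE : E ⊆ unitDisc) (hinf : E.Infinite) (hq : IsWeight E q) (n : ℕ) :
    vMax E q n * mMin E q n ≤ vMax E q (n + 1) := by
  obtain ⟨Z, hZ, hV, h⟩ := exists_maxOn_eq_mMin hE hinf hq n
  rw [mul_comm, ← le_div_iff₀ (vMax_pos hE hinf hq n), ← h]
  refine maxOn_le hinf.nonempty fun z hz => ?_
  rw [le_div_iff₀ (vMax_pos hE hinf hq n), mul_comm, ← hV, ← vandermonde_cons]
  refine vandermonde_le_vMax hq fun j => ?_
  refine Fin.cases ?_ (fun i => ?_) j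
  · simpa using subset_relClosure hE hz
  · simpa using hZ i

/-- Extremal tuples are well separated. -/
theorem vMax_succ_le (hq : IsWeight E q) {Z : Fin (n + 1) → ℂ} (hZ : ∀ j, Z j ∈ relClosure E)
    (hV : vandermonde q Z = vMax E q (n + 1)) (p : Fin (n + 1)) :
    vMax E q (n + 1) ≤ vMax E q n * ‖genBlaschke q (Z ∘ p.succAbove) (Z p)‖ := by
  rw [← hV, vandermonde_eq_mul q Z p]
  exact mul_le_mul_of_nonneg_right (vandermonde_le_vMax hq fun j => hZ _) (norm_nonneg _)

theorem mMin_le_norm_genBlaschke (hE : E ⊆ unitDisc) (hinf : E.Infinite) (hq : IsWeight E q)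
    {Z : Fin (n + 1) → ℂ} (hZ : ∀ j, Z j ∈ relClosure E)
    (hV : vandermonde q Z = vMax E q (n + 1)) (p : Fin (n + 1)) :
    mMin E q n ≤ ‖genBlaschke q (Z ∘ p.succAbove) (Z p)‖ :=
  le_of_mul_le_mul_left ((vMax_mul_mMin_le hE hinf hq n).trans (vMax_succ_le hq hZ hV p))
    (vMax_pos hE hinf hq n)

/-- If M_n ≥ δ, every omit-one value of an extremal (n+1)-tuple is at least δ. The weight then
confines all its points to |z| ≤ ρ, where a product of n Blaschke factors is at most c^n < δ for
large n. -/
theorem tendsto_mMin (hE : E ⊆ unitDisc) (hinf : E.Infinite) (hq : IsWeight E q) :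
    Tendsto (mMin E q) atTop (𝓝 0) := by
  rw [Metric.tendsto_atTop]
  intro δ hδ
  obtain ⟨ρ, hρ, h⟩ := hq.exists_norm_lt hδ
  obtain ⟨c, hc0, hc1, hc⟩ := exists_norm_blaschkeFactor_le hρ
  obtain ⟨N, hN⟩ := exists_pow_lt_of_lt_one hδ hc1
  refine ⟨N, fun n hn => ?_⟩
  rw [Real.dist_eq, sub_zero, abs_of_pos (mMin_pos hE hinf hq n)]
  obtain ⟨Z, hZ, hV⟩ := exists_vandermonde_eq_vMax hE hinf hq (n + 1)
  by_contra! hlt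
  have hZ' : ∀ j, Z j ∈ unitDisc := fun j => (hZ j).2
  have h1 : ∀ p, δ ≤ ‖genBlaschke q (Z ∘ p.succAbove) (Z p)‖ := fun p =>
    hlt.trans (mMin_le_norm_genBlaschke hE hinf hq hZ hV p)
  have h2 : ∀ p, ‖Z p‖ ≤ ρ := fun p => by
    by_contra! hp
    exact absurd ((h1 p).trans (norm_genBlaschke_le_weight (fun j => hZ' _) (hZ' p)))
      (not_le.2 (h _ (hZ p) hp))
  have h3 : ‖genBlaschke q (Z ∘ Fin.succAbove 0) (Z 0)‖ ≤ c ^ n := by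
    rw [norm_genBlaschke]
    refine (mul_le_of_le_one_right (Finset.prod_nonneg fun _ _ => norm_nonneg _)
      (hq.norm_le_one (hZ' 0))).trans ?_
    refine (Finset.prod_le_prod (fun _ _ => norm_nonneg _) fun j _ => hc _ _ (h2 _) (h2 _)).trans ?_
    simp
  exact absurd ((h1 0).trans (h3.trans (pow_le_pow_of_le_one hc0 hc1.le hn))) (not_le.2 hN)

end HardyStability
-- Interpolation at extremal tuples and the upper bound.
namespace HardyStability

variable {E : Set ℂ} {q : ℂ → ℂ} {n : ℕ}

theorem genBlaschke_eq_zero {Z : Fin n → ℂ} (i : Fin n) : genBlaschke q Z (Z i) = 0 := by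
  rw [genBlaschke, Finset.prod_eq_zero (Finset.mem_univ i) (blaschkeFactor_self _), zero_mul]

theorem genBlaschke_succAbove_eq_zero {Z : Fin (n + 1) → ℂ} {j k : Fin (n + 1)} (h : k ≠ j) :
    genBlaschke q (Z ∘ j.succAbove) (Z k) = 0 := by
  obtain ⟨i, rfl⟩ := Fin.exists_succAbove_eq h
  exact genBlaschke_eq_zero (Z := Z ∘ j.succAbove) i

theorem prod_norm_blaschkeFactor_le {R : ℝ} (hR0 : 0 < R) (hR1 : R < 1) {Z : Fin n → ℂ}
    (hZ : ∀ j, Z j ∈ unitDisc) {z : ℂ} (hz : ‖z‖ ≤ R) :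
    ∏ j, ‖blaschkeFactor (Z j) z‖ ≤ (∏ j, max R ‖Z j‖) ^ (R ^ 2 * (1 - R ^ 2) / 4) := by
  rw [← Real.finsetProd_rpow _ _ fun j _ => hR0.le.trans (le_max_left _ _)]
  exact Finset.prod_le_prod (fun _ _ => norm_nonneg _)
    fun j _ => norm_blaschkeFactor_le_max_rpow hR0 hR1 (mem_unitDisc.1 (hZ j)) hz

/-- Restoring the omitted factor max{R, |z_j|}^α ≥ R^α costs R^{-α} and makes the bound independent
of j. -/
theorem norm_genBlaschke_succAbove_le {R : ℝ} (hR0 : 0 < R) (hR1 : R < 1) (hq : IsWeight E q)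
    {Z : Fin (n + 1) → ℂ} (hZ : ∀ j, Z j ∈ unitDisc) {z : ℂ} (hz : ‖z‖ ≤ R) (j : Fin (n + 1)) :
    ‖genBlaschke q (Z ∘ j.succAbove) z‖ ≤ R ^ (-(R ^ 2 * (1 - R ^ 2) / 4)) *
      (∏ j, max R ‖Z j‖) ^ (R ^ 2 * (1 - R ^ 2) / 4) := by
  set α := R ^ 2 * (1 - R ^ 2) / 4 with hα
  have hα0 : 0 ≤ α := by
    have : 0 < 1 - R ^ 2 := by nlinarith
    positivity
  have hzU : z ∈ unitDisc := mem_unitDisc.2 (hz.trans_lt hR1)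
  have hpos : 0 ≤ ∏ i, max R ‖Z (j.succAbove i)‖ :=
    Finset.prod_nonneg fun i _ => hR0.le.trans (le_max_left _ _)
  have h1 : ‖genBlaschke q (Z ∘ j.succAbove) z‖ ≤ (∏ i, max R ‖Z (j.succAbove i)‖) ^ α := by
    rw [norm_genBlaschke]
    exact (mul_le_of_le_one_right (Finset.prod_nonneg fun _ _ => norm_nonneg _)
      (hq.norm_le_one hzU)).trans (prod_norm_blaschkeFactor_le hR0 hR1 (fun i => hZ _) hz)
  refine h1.trans ?_
  rw [Fin.prod_univ_succAbove _ j, Real.mul_rpow (hR0.le.trans (le_max_left _ _)) hpos,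
    ← mul_assoc]
  refine le_mul_of_one_le_left (Real.rpow_nonneg hpos _) ?_
  rw [Real.rpow_neg hR0.le, ← div_eq_inv_mul, one_le_div (Real.rpow_pos_of_pos hR0 _)]
  exact Real.rpow_le_rpow hR0.le (le_max_left _ _) hα0

/-- Interpolation at an extremal tuple. -/
theorem norm_le_of_mul_le_mMin {R : ℝ} (hR0 : 0 < R) (hR1 : R < 1) (hE : E ⊆ unitDisc)
    (hinf : E.Infinite) (hq : IsWeight E q) {Z : Fin (n + 1) → ℂ}
    (hZ : ∀ j, Z j ∈ relClosure E) (hV : vandermonde q Z = vMax E q (n + 1)) {ε : ℝ}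
    (hn : (n + 1 : ℝ) * ε ≤ mMin E q n) {p : ℝ≥0∞} (hp : 1 ≤ p) {g : ℂ → ℂ}
    (hg : DifferentiableOn ℂ g unitDisc) (hgp : hardyNorm p g ≤ 1) (hgE : ∀ ζ ∈ E, ‖g ζ‖ ≤ ε)
    {z : ℂ} (hz : ‖z‖ ≤ R) :
    ‖g z‖ ≤ (R ^ (-(R ^ 2 * (1 - R ^ 2) / 4)) + 2 / (1 - R)) *
      (∏ j, max R ‖Z j‖) ^ (R ^ 2 * (1 - R ^ 2) / 4) := by
  classical
  have hZ' : ∀ j, Z j ∈ unitDisc := fun j => (hZ j).2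
  have hm := mMin_pos hE hinf hq n
  have hG : ∀ j, mMin E q n ≤ ‖genBlaschke q (Z ∘ j.succAbove) (Z j)‖ :=
    mMin_le_norm_genBlaschke hE hinf hq hZ hV
  have hε : 0 ≤ ε := by
    obtain ⟨ζ, hζ⟩ := hinf.nonempty
    exact (norm_nonneg _).trans (hgE ζ hζ)
  let L : ℂ → ℂ := fun w => ∑ j, g (Z j) / genBlaschke q (Z ∘ j.succAbove) (Z j) *
    genBlaschke q (Z ∘ j.succAbove) w
  have hLd : DifferentiableOn ℂ L unitDisc := DifferentiableOn.fun_sum fun j _ =>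
    (differentiableOn_genBlaschke hq fun i => hZ' _).const_mul _
  -- There are n+1 terms, each at most (ε/M_n)c, and (n+1)ε ≤ M_n. Used with c = 1 on the whole disc
  -- and with the finer bound on |z| ≤ R.
  have hL : ∀ (w : ℂ) (c : ℝ), 0 ≤ c → (∀ j, ‖genBlaschke q (Z ∘ Fin.succAbove j) w‖ ≤ c) →
      ‖L w‖ ≤ c := by
    intro w c hc h
    have h1 : ∀ j ∈ Finset.univ, ‖g (Z j) / genBlaschke q (Z ∘ Fin.succAbove j) (Z j) *
        genBlaschke q (Z ∘ Fin.succAbove j) w‖ ≤ ε / mMin E q n * c := by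
      intro j _
      rw [norm_mul, norm_div]
      refine mul_le_mul (div_le_div₀ hε ?_ hm (hG j)) (h j) (norm_nonneg _) (by positivity)
      -- The nodes lie only in the closure of E, so |g| ≤ ε there by continuity.
      exact norm_le_of_mem_relClosure hg.continuousOn isOpen_univ (fun ζ hζ => hgE ζ hζ.1)
        (hZ j) (mem_univ _)
    refine (norm_sum_le_of_le _ h1).trans ?_
    rw [Finset.sum_const, Finset.card_univ, Fintype.card_fin, nsmul_eq_mul, ← mul_assoc]
    refine mul_le_of_le_one_left hc ?_
    rw [mul_div_assoc', div_le_one hm]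
    exact_mod_cast hn
  have hLZ : ∀ k, L (Z k) = g (Z k) := by
    intro k
    refine (Finset.sum_eq_single k (fun j _ hj => ?_) (by simp)).trans ?_
    · rw [genBlaschke_succAbove_eq_zero hj.symm, mul_zero]
    · exact div_mul_cancel₀ _ (norm_pos_iff.1 (hm.trans_le (hG k)))
  -- A repeated node would make an omit-one value vanish; distinctness turns the tuple into a finite
  -- set of zeros without losing factors.
  have hinj : Function.Injective Z := by
    intro i j hij
    by_contra hne
    have h1 := hm.trans_le (hG j)
    rw [← hij, genBlaschke_succAbove_eq_zero hne, norm_zero] at h1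
    exact lt_irrefl _ h1
  have h1 := norm_sub_le_prod_blaschkeFactor hg hp hgp hLd zero_le_one
    (fun w hw => hL w 1 zero_le_one fun j => norm_genBlaschke_le_one hq (fun i => hZ' _) hw)
    (Finset.univ.image Z) (fun a ha => by
      obtain ⟨k, -, rfl⟩ := Finset.mem_image.1 ha
      exact ⟨hZ' k, hLZ k⟩) hR1 hz
  rw [Finset.prod_image fun _ _ _ _ h => hinj h, one_add_one_eq_two] at h1
  have h2 : ‖L z‖ ≤ R ^ (-(R ^ 2 * (1 - R ^ 2) / 4)) *
      (∏ j, max R ‖Z j‖) ^ (R ^ 2 * (1 - R ^ 2) / 4) :=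
    hL z _ (mul_nonneg (Real.rpow_nonneg hR0.le _) (Real.rpow_nonneg
      (Finset.prod_nonneg fun i _ => hR0.le.trans (le_max_left _ _)) _))
      (norm_genBlaschke_succAbove_le hR0 hR1 hq hZ' hz)
  have h3 : ‖g z‖ ≤ ‖g z - L z‖ + ‖L z‖ := by
    simpa using norm_add_le (g z - L z) (L z)
  have h4 : 2 / (1 - R) * ∏ j, ‖blaschkeFactor (Z j) z‖ ≤
      2 / (1 - R) * (∏ j, max R ‖Z j‖) ^ (R ^ 2 * (1 - R ^ 2) / 4) :=
    mul_le_mul_of_nonneg_left (prod_norm_blaschkeFactor_le hR0 hR1 hZ' hz)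
      (div_nonneg zero_le_two (by linarith))
  linarith

/-- If `n + 1` points suffice to make `M_{n+1} ≤ δ` while `M_n` is not too small, then
`stabilityConst` is controlled by `gFun` at `δ`. -/
theorem stabilityConst_le_gFun {R : ℝ} (hR0 : 0 < R) (hR1 : R < 1) (hE : E ⊆ unitDisc)
    (hinf : E.Infinite) (hq : IsWeight E q) {ε δ : ℝ} (hδ : mMin E q (n + 1) ≤ δ)
    (hn : (n + 1 : ℝ) * ε ≤ mMin E q n) {p : ℝ≥0∞} (hp : 1 ≤ p) :
    stabilityConst E p ε R ≤ (R ^ (-(R ^ 2 * (1 - R ^ 2) / 4)) + 2 / (1 - R)) *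
      ‖q 0‖ ^ (-(R ^ 2 * (1 - R ^ 2) / 4)) * gFun E q R δ ^ (R ^ 2 * (1 - R ^ 2) / 4) := by
  obtain ⟨Z, hZ, hV, hM⟩ := exists_maxOn_eq_mMin hE hinf hq (n + 1)
  set α := R ^ 2 * (1 - R ^ 2) / 4 with hα
  have hα0 : 0 ≤ α := by
    have : 0 < 1 - R ^ 2 := by nlinarith
    positivity
  have hC : 0 ≤ R ^ (-α) + 2 / (1 - R) :=
    add_nonneg (Real.rpow_nonneg hR0.le _) (div_nonneg zero_le_two (by linarith))
  have hq0 : 0 < ‖q 0‖ := hq.norm_pos (by simp [unitDisc])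
  have hP : 0 ≤ ∏ j, max R ‖Z j‖ :=
    Finset.prod_nonneg fun i _ => hR0.le.trans (le_max_left _ _)
  have hle : ‖q 0‖ * ∏ j, max R ‖Z j‖ ≤ gFun E q R δ := by
    have := le_gFun hR0 hR1 hq (s := 1) le_rfl (Nat.le_add_left 1 n) hZ (ε := δ) (by rwa [pow_one, hM])
    rwa [pow_one] at this
  have hbound : (∏ j, max R ‖Z j‖) ^ α ≤ ‖q 0‖ ^ (-α) * gFun E q R δ ^ α := by
    rw [Real.rpow_neg hq0.le, ← div_eq_inv_mul, le_div_iff₀' (Real.rpow_pos_of_pos hq0 _),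
      ← Real.mul_rpow hq0.le hP]
    exact Real.rpow_le_rpow (mul_nonneg hq0.le hP) hle hα0
  have hg0 : 0 ≤ gFun E q R δ := (mul_nonneg hq0.le hP).trans hle
  refine stabilityConst_le (mul_nonneg (mul_nonneg hC (Real.rpow_nonneg hq0.le _))
    (Real.rpow_nonneg hg0 _)) fun g hg hgp hgE z hz => ?_
  rw [mul_assoc]
  exact (norm_le_of_mul_le_mMin hR0 hR1 hE hinf hq hZ hV hn hp hg hgp hgE hz).trans
    (mul_le_mul_of_nonneg_left hbound hC)

end HardyStability
-- Existence of a weight from condition (G).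
namespace HardyStability

/-- The angles of the boundary points seen from the points of `E` with `|z| > 1 - 1 / (m + 1)`. -/
def shadow (E : Set ℂ) (m : ℕ) : Set ℝ :=
  {θ : ℝ | ∃ z ∈ E, 1 - 1 / ((m : ℝ) + 1) < ‖z‖ ∧
    ‖z - Complex.exp (θ * Complex.I)‖ < 2 * (1 - ‖z‖)}

theorem isOpen_shadow (E : Set ℂ) (m : ℕ) : IsOpen (shadow E m) := by
  have h : shadow E m = ⋃ z ∈ {z ∈ E | 1 - 1 / ((m : ℝ) + 1) < ‖z‖},
      {θ : ℝ | ‖z - Complex.exp (θ * Complex.I)‖ < 2 * (1 - ‖z‖)} := by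
    ext θ
    simp [shadow, and_assoc]
  rw [h]
  exact isOpen_biUnion fun z _ => isOpen_lt (by fun_prop) continuous_const

theorem antitone_shadow (E : Set ℂ) : Antitone (shadow E) := by
  rintro m k hmk θ ⟨z, hz, h1, h2⟩
  refine ⟨z, hz, lt_of_le_of_lt ?_ h1, h2⟩
  have : 1 / ((k : ℝ) + 1) ≤ 1 / ((m : ℝ) + 1) := by gcongr
  linarith

/-- An angle in every shadow is approached nontangentially by points of E, so the intersection is
null by (G); continuity from above does the rest. -/
theorem tendsto_shadow {E : Set ℂ} (hE : E ⊆ unitDisc) (hG : ConditionG E) :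
    Tendsto (fun m => angleMeasure (shadow E m)) atTop (𝓝 0) := by
  have h := tendsto_measure_iInter_atTop (μ := angleMeasure)
    (fun m => (isOpen_shadow E m).measurableSet.nullMeasurableSet) (antitone_shadow E)
    ⟨0, measure_ne_top _ _⟩
  suffices h0 : angleMeasure (⋂ m, shadow E m) = 0 by rwa [h0] at h
  refine measure_mono_null (fun θ hθ => ?_) hG
  have hθ' : ∀ m, θ ∈ shadow E m := fun m => mem_iInter.1 hθ m
  choose z hz h1 h2 using hθ'
  have hlim : Tendsto (fun m => 1 - ‖z m‖) atTop (𝓝 0) := by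
    refine squeeze_zero (fun m => ?_) (fun m => ?_) (tendsto_one_div_add_atTop_nhds_zero_nat (𝕜 := ℝ))
    · linarith [mem_unitDisc.1 (hE (hz m))]
    · linarith [h1 m]
  refine ⟨Complex.norm_exp_ofReal_mul_I θ, z, hz, ?_, ?_⟩
  · rw [tendsto_iff_norm_sub_tendsto_zero]
    refine squeeze_zero (fun m => norm_nonneg _) (fun m => (h2 m).le) ?_
    simpa using hlim.const_mul 2
  · refine Asymptotics.IsBigO.of_bound 2 (Eventually.of_forall fun m => (h2 m).le.trans ?_)
    gcongr
    exact le_abs_self _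

/-- The arc of boundary points close to `z` has measure comparable with `1 - |z|`. -/
theorem le_angleMeasure_arc {z : ℂ} (hz : ‖z‖ < 1) :
    ENNReal.ofReal ((1 - ‖z‖) / (2 * Real.pi)) ≤
      angleMeasure {θ : ℝ | ‖z - Complex.exp (θ * Complex.I)‖ < 2 * (1 - ‖z‖)} := by
  set δ := 1 - ‖z‖ with hδ
  have hδ0 : 0 < δ := by linarith
  have hδ1 : δ ≤ 1 := by linarith [norm_nonneg z]
  have hpi := Real.pi_gt_three
  obtain ⟨t, ht, hzt⟩ : ∃ t ∈ Ico (0 : ℝ) (2 * Real.pi),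
      z = ‖z‖ * Complex.exp (t * Complex.I) := by
    refine ⟨toIcoMod Real.two_pi_pos 0 z.arg, by simpa using toIcoMod_mem_Ico Real.two_pi_pos 0 z.arg, ?_⟩
    have h1 : Complex.exp (toIcoMod Real.two_pi_pos 0 z.arg * Complex.I) =
        Complex.exp (z.arg * Complex.I) := by
      refine Complex.exp_eq_exp_iff_exists_int.2 ⟨-toIcoDiv Real.two_pi_pos 0 z.arg, ?_⟩
      rw [toIcoMod]
      push_cast [zsmul_eq_mul]
      ring
    rw [h1]
    exact (Complex.norm_mul_exp_arg_mul_I z).symm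
  have hnear : ∀ θ : ℝ, |θ - t| < δ → ‖z - Complex.exp (θ * Complex.I)‖ < 2 * δ := by
    intro θ hθ
    have h1 : ‖z - Complex.exp (t * Complex.I)‖ = δ := by
      have : z - Complex.exp (t * Complex.I) = ((‖z‖ - 1 : ℝ) : ℂ) * Complex.exp (t * Complex.I) := by
        conv_lhs => rw [hzt]
        push_cast
        ring
      rw [this, norm_mul, Complex.norm_exp_ofReal_mul_I, mul_one, Complex.norm_real,
        Real.norm_eq_abs, abs_sub_comm, abs_of_pos hδ0]
    have h2 : ‖Complex.exp (t * Complex.I) - Complex.exp (θ * Complex.I)‖ ≤ |θ - t| := by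
      have e : Complex.exp (t * Complex.I) - Complex.exp (θ * Complex.I) =
          -(Complex.exp (t * Complex.I) * (Complex.exp (Complex.I * (θ - t : ℝ)) - 1)) := by
        rw [mul_sub, ← Complex.exp_add]
        push_cast
        ring_nf
      rw [e, norm_neg, norm_mul, Complex.norm_exp_ofReal_mul_I, one_mul]
      exact Real.norm_exp_I_mul_ofReal_sub_one_le
    calc ‖z - Complex.exp (θ * Complex.I)‖ ≤ _ :=
          norm_sub_le_norm_sub_add_norm_sub _ (Complex.exp (t * Complex.I)) _
      _ < 2 * δ := by linarith
  -- A one-sided arc of length δ ≤ 1 suffices: to the right of t when t ≤ π, to the left otherwise,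
  -- so that it does not leave the period.
  have hmain : ∀ a : ℝ, Ioo a (a + δ) ⊆ Ioc 0 (2 * Real.pi) →
      (∀ θ ∈ Ioo a (a + δ), |θ - t| < δ) → ENNReal.ofReal (δ / (2 * Real.pi)) ≤
      angleMeasure {θ : ℝ | ‖z - Complex.exp (θ * Complex.I)‖ < 2 * δ} := by
    intro a ha hat
    refine le_trans ?_ (measure_mono fun θ hθ => hnear θ (hat θ hθ))
    rw [angleMeasure, Measure.smul_apply, Measure.restrict_apply measurableSet_Ioo,
      inter_eq_self_of_subset_left ha, Real.volume_Ioo, smul_eq_mul,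
      ← ENNReal.ofReal_mul (by positivity)]
    exact ENNReal.ofReal_le_ofReal (by rw [add_sub_cancel_left]; exact le_of_eq (by ring))
  rcases le_or_gt t Real.pi with h | h
  · refine hmain t (fun θ hθ => ⟨ht.1.trans_lt hθ.1, by linarith [hθ.2]⟩) fun θ hθ => ?_
    rw [abs_lt]
    exact ⟨by linarith [hθ.1], by linarith [hθ.2]⟩
  · refine hmain (t - δ) (fun θ hθ => ⟨by linarith [hθ.1], by linarith [hθ.2, ht.2]⟩) fun θ hθ => ?_
    rw [abs_lt]
    exact ⟨by linarith [hθ.1], by linarith [hθ.2]⟩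

/-- The Herglotz kernel. -/
noncomputable def herglotzKernel (z : ℂ) (θ : ℝ) : ℂ :=
  (Complex.exp (θ * Complex.I) + z) / (Complex.exp (θ * Complex.I) - z)

theorem exp_sub_ne_zero {z : ℂ} (hz : ‖z‖ < 1) (θ : ℝ) : Complex.exp (θ * Complex.I) - z ≠ 0 := by
  refine sub_ne_zero.2 fun h => hz.ne ?_
  rw [← h, Complex.norm_exp_ofReal_mul_I]

theorem le_norm_exp_sub (z : ℂ) (θ : ℝ) : 1 - ‖z‖ ≤ ‖Complex.exp (θ * Complex.I) - z‖ := by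
  have := norm_sub_norm_le (Complex.exp (θ * Complex.I)) z
  rwa [Complex.norm_exp_ofReal_mul_I] at this

theorem continuous_herglotzKernel {z : ℂ} (hz : ‖z‖ < 1) : Continuous (herglotzKernel z) := by
  unfold herglotzKernel
  exact Continuous.div (by fun_prop) (by fun_prop) (exp_sub_ne_zero hz)

theorem norm_herglotzKernel_le {z : ℂ} (hz : ‖z‖ < 1) (θ : ℝ) :
    ‖herglotzKernel z θ‖ ≤ 2 / (1 - ‖z‖) := by
  rw [herglotzKernel, norm_div]
  refine div_le_div₀ zero_le_two ?_ (by linarith) (le_norm_exp_sub z θ)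
  refine (norm_add_le _ _).trans ?_
  rw [Complex.norm_exp_ofReal_mul_I]
  linarith

theorem re_herglotzKernel {z : ℂ} (hz : ‖z‖ < 1) (θ : ℝ) : (herglotzKernel z θ).re =
    (1 - ‖z‖ ^ 2) / ‖z - Complex.exp (θ * Complex.I)‖ ^ 2 := by
  have hne := exp_sub_ne_zero hz θ
  have h1 : Complex.normSq (Complex.exp (θ * Complex.I)) = 1 := by
    rw [Complex.normSq_eq_norm_sq, Complex.norm_exp_ofReal_mul_I, one_pow]
  rw [herglotzKernel, Complex.div_re, norm_sub_rev, Complex.sq_norm, Complex.sq_norm,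
    ← add_div, ← h1]
  congr 1
  simp only [Complex.add_re, Complex.add_im, Complex.sub_re, Complex.sub_im,
    Complex.normSq_apply]
  ring

theorem integrable_herglotzKernel (ν : Measure ℝ) [IsFiniteMeasure ν] {z : ℂ} (hz : ‖z‖ < 1) :
    Integrable (herglotzKernel z) ν :=
  Integrable.of_bound (continuous_herglotzKernel hz).aestronglyMeasurable _
    (Eventually.of_forall (norm_herglotzKernel_le hz))

theorem differentiableOn_integral_herglotzKernel (ν : Measure ℝ) [IsFiniteMeasure ν] :
    DifferentiableOn ℂ (fun z => ∫ θ, herglotzKernel z θ ∂ν) unitDisc := by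
  intro z₀ hz₀
  have hz₀' : ‖z₀‖ < 1 := mem_unitDisc.1 hz₀
  obtain ⟨r, hr0, hr1⟩ := exists_between hz₀'
  have hr : 0 < 1 - r := by linarith
  have hs : Metric.ball (0 : ℂ) r ∈ 𝓝 z₀ :=
    Metric.isOpen_ball.mem_nhds (by simpa using hr0)
  have hlt : ∀ z ∈ Metric.ball (0 : ℂ) r, ‖z‖ < r := fun z hz => by simpa using hz
  refine DifferentiableAt.differentiableWithinAt ?_
  refine (hasDerivAt_integral_of_dominated_loc_of_deriv_le (F := fun z θ => herglotzKernel z θ)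
    (F' := fun z θ => 2 * Complex.exp (θ * Complex.I) / (Complex.exp (θ * Complex.I) - z) ^ 2)
    (bound := fun _ => 2 / (1 - r) ^ 2) hs ?_ (integrable_herglotzKernel ν hz₀') ?_ ?_
    (integrable_const _) ?_).2.differentiableAt
  · filter_upwards [hs] with z hz
    exact (continuous_herglotzKernel ((hlt z hz).trans hr1)).aestronglyMeasurable
  · exact (Continuous.div (by fun_prop) (by fun_prop)
      fun θ => pow_ne_zero 2 (exp_sub_ne_zero hz₀' θ)).aestronglyMeasurable
  · refine Eventually.of_forall fun θ z hz => ?_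
    rw [norm_div, norm_mul, norm_pow, Complex.norm_exp_ofReal_mul_I, mul_one, Complex.norm_ofNat]
    refine div_le_div_of_nonneg_left zero_le_two (by positivity) ?_
    have := le_norm_exp_sub z θ
    exact pow_le_pow_left₀ hr.le (by linarith [hlt z hz]) 2
  · refine Eventually.of_forall fun θ z hz => ?_
    have hne := exp_sub_ne_zero ((hlt z hz).trans hr1) θ
    have h1 := ((hasDerivAt_id z).const_add (Complex.exp (θ * Complex.I))).div
      ((hasDerivAt_id z).const_sub (Complex.exp (θ * Complex.I))) hne
    have h2 : HasDerivAt (fun z => herglotzKernel z θ) _ z := h1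
    refine h2.congr_deriv ?_
    simp only [id]
    ring

theorem re_integral_herglotzKernel (ν : Measure ℝ) [IsFiniteMeasure ν] {z : ℂ} (hz : ‖z‖ < 1) :
    (∫ θ, herglotzKernel z θ ∂ν).re =
      ∫ θ, (1 - ‖z‖ ^ 2) / ‖z - Complex.exp (θ * Complex.I)‖ ^ 2 ∂ν := by
  simp_rw [← re_herglotzKernel hz]
  exact (integral_re (integrable_herglotzKernel ν hz)).symm

theorem re_integral_herglotzKernel_nonneg (ν : Measure ℝ) [IsFiniteMeasure ν] {z : ℂ}
    (hz : ‖z‖ < 1) : 0 ≤ (∫ θ, herglotzKernel z θ ∂ν).re := by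
  rw [re_integral_herglotzKernel ν hz]
  exact integral_nonneg fun θ => div_nonneg (by nlinarith [norm_nonneg z]) (sq_nonneg _)

/-- The Poisson integral is bounded below by the mass near `z`. -/
theorem le_re_integral_herglotzKernel (ν : Measure ℝ) [IsFiniteMeasure ν] {z : ℂ}
    (hz : ‖z‖ < 1) :
    ν.real {θ : ℝ | ‖z - Complex.exp (θ * Complex.I)‖ < 2 * (1 - ‖z‖)} / (4 * (1 - ‖z‖)) ≤
      (∫ θ, herglotzKernel z θ ∂ν).re := by
  set I := {θ : ℝ | ‖z - Complex.exp (θ * Complex.I)‖ < 2 * (1 - ‖z‖)} with hI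
  have hδ : 0 < 1 - ‖z‖ := by linarith
  have hIm : MeasurableSet I := (isOpen_lt (by fun_prop) continuous_const).measurableSet
  have hint : Integrable (fun θ : ℝ => (1 - ‖z‖ ^ 2) / ‖z - Complex.exp (θ * Complex.I)‖ ^ 2) ν := by
    simp_rw [← re_herglotzKernel hz]
    exact (integrable_herglotzKernel ν hz).re
  rw [re_integral_herglotzKernel ν hz]
  have h1 : ∫ θ, I.indicator (fun _ => 1 / (4 * (1 - ‖z‖))) θ ∂ν =
      ν.real I / (4 * (1 - ‖z‖)) := by
    rw [integral_indicator_const _ hIm, smul_eq_mul, mul_one_div]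
  rw [← h1]
  refine integral_mono ((integrable_const _).indicator hIm) hint fun θ => ?_
  by_cases hθ : θ ∈ I
  · rw [indicator_of_mem hθ]
    have h2 : 0 < ‖z - Complex.exp (θ * Complex.I)‖ := by
      rw [norm_sub_rev]
      exact norm_pos_iff.2 (exp_sub_ne_zero hz θ)
    have h3 : ‖z - Complex.exp (θ * Complex.I)‖ < 2 * (1 - ‖z‖) := hθ
    show 1 / (4 * (1 - ‖z‖)) ≤ (1 - ‖z‖ ^ 2) / ‖z - Complex.exp (θ * Complex.I)‖ ^ 2
    rw [div_le_div_iff₀ (by linarith) (by positivity)]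
    nlinarith [norm_nonneg z, mul_nonneg (norm_nonneg z) (sq_nonneg (1 - ‖z‖))]
  · rw [indicator_of_notMem hθ]
    exact div_nonneg (by nlinarith [norm_nonneg z]) (sq_nonneg _)

/-- A holomorphic function with nonnegative real part that tends to infinity along `E`. -/
theorem exists_re_tendsto_atTop {E : Set ℂ} (hE : E ⊆ unitDisc) (hG : ConditionG E) :
    ∃ f : ℂ → ℂ, DifferentiableOn ℂ f unitDisc ∧ (∀ z ∈ unitDisc, 0 ≤ (f z).re) ∧
      ∀ C : ℝ, ∃ ρ : ℝ, ρ < 1 ∧ ∀ z ∈ E, ρ < ‖z‖ → C < (f z).re := by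
  have hex : ∀ k : ℕ, ∃ m : ℕ, angleMeasure (shadow E m) ≤ (2⁻¹ : ℝ≥0∞) ^ k := fun k =>
    ((tendsto_shadow hE hG).eventually (ge_mem_nhds (ENNReal.pow_pos (by simp) k))).exists
  choose m hm using hex
  -- The bounds 2^{-k} make ν finite, while the arc seen from a point of E near the circle lies in
  -- arbitrarily many shadows, so it is counted with large multiplicity.
  let ν : Measure ℝ := Measure.sum fun k => angleMeasure.restrict (shadow E (m k))
  have hν : IsFiniteMeasure ν := by
    constructor
    rw [Measure.sum_apply _ MeasurableSet.univ]
    simp only [Measure.restrict_apply_univ]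
    refine (ENNReal.tsum_le_tsum hm).trans_lt ?_
    rw [ENNReal.tsum_geometric]
    simp
  refine ⟨fun z => ∫ θ, herglotzKernel z θ ∂ν, differentiableOn_integral_herglotzKernel ν,
    fun z hz => re_integral_herglotzKernel_nonneg ν (mem_unitDisc.1 hz), fun C => ?_⟩
  -- K overlapping shadows give the arc mass at least K(1 - |z|)/(2π); division by 4(1 - |z|) leaves
  -- K/(8π) > C.
  obtain ⟨K, hK⟩ := exists_nat_gt (8 * Real.pi * C)
  obtain ⟨N, hN⟩ : ∃ N : ℕ, ∀ k ∈ Finset.range K, m k ≤ N :=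
    ⟨(Finset.range K).sup m, fun k hk => Finset.le_sup hk⟩
  refine ⟨1 - 1 / ((N : ℝ) + 1), sub_lt_self _ (by positivity), fun z hz hzN => ?_⟩
  have hz1 := mem_unitDisc.1 (hE hz)
  have hδ : 0 < 1 - ‖z‖ := by linarith
  refine lt_of_lt_of_le ?_ (le_re_integral_herglotzKernel ν hz1)
  set I := {θ : ℝ | ‖z - Complex.exp (θ * Complex.I)‖ < 2 * (1 - ‖z‖)} with hI
  have hIm : MeasurableSet I := (isOpen_lt (by fun_prop) continuous_const).measurableSet
  have h1 : ENNReal.ofReal (K * ((1 - ‖z‖) / (2 * Real.pi))) ≤ ν I := by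
    rw [Measure.sum_apply _ hIm]
    refine le_trans ?_ (ENNReal.sum_le_tsum (Finset.range K))
    have h2 : ∀ k ∈ Finset.range K, angleMeasure I ≤ angleMeasure.restrict (shadow E (m k)) I := by
      intro k hk
      rw [Measure.restrict_apply hIm, inter_eq_self_of_subset_left]
      exact fun θ hθ => antitone_shadow E (hN k hk) ⟨z, hz, hzN, hθ⟩
    refine le_trans ?_ (Finset.sum_le_sum h2)
    rw [Finset.sum_const, Finset.card_range, nsmul_eq_mul, ENNReal.ofReal_mul (by positivity),
      ENNReal.ofReal_natCast]
    gcongr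
    exact le_angleMeasure_arc hz1
  have h3 : K * ((1 - ‖z‖) / (2 * Real.pi)) ≤ ν.real I :=
    (ENNReal.ofReal_le_iff_le_toReal (measure_ne_top _ _)).1 h1
  rw [lt_div_iff₀ (by linarith)]
  refine lt_of_lt_of_le ?_ h3
  rw [mul_div_assoc', lt_div_iff₀ (by positivity)]
  nlinarith [mul_lt_mul_of_pos_right hK hδ]

/-- If the closure of E misses the circle, E stays in a smaller disc and q = 1 has nothing to
satisfy near the boundary. Otherwise exp(-f), divided by its supremum, decays along E because Re f →
∞ there. -/
theorem exists_isWeight {E : Set ℂ} (hE : E ⊆ unitDisc) (hG : ConditionG E) :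
    ∃ q : ℂ → ℂ, IsWeight E q := by
  have h0 : (0 : ℂ) ∈ unitDisc := by simp [unitDisc]
  by_cases hdisj : Disjoint (closure E) (Metric.sphere (0 : ℂ) 1)
  · refine ⟨fun _ => 1, differentiableOn_const _, fun _ _ => one_ne_zero, ?_, fun δ _ => ?_,
      fun _ _ _ => rfl⟩
    · have : (fun _ : ℂ => ‖(1 : ℂ)‖) '' unitDisc = {1} := by
        simp only [norm_one]
        exact Nonempty.image_const ⟨0, h0⟩ 1
      rw [this]
      exact isLUB_singleton
    · have hcomp : IsCompact (closure E) := by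
        refine (isCompact_closedBall (0 : ℂ) 1).of_isClosed_subset isClosed_closure ?_
        exact closure_minimal (hE.trans Metric.ball_subset_closedBall) Metric.isClosed_closedBall
      rcases E.eq_empty_or_nonempty with rfl | hne
      · exact ⟨0, one_pos, fun z hz => hz.elim⟩
      obtain ⟨w, hw, hmax⟩ := hcomp.exists_isMaxOn hne.closure continuous_norm.continuousOn
      refine ⟨‖w‖, lt_of_le_of_ne ?_ fun h => ?_, fun z hz hlt => ?_⟩
      · have : w ∈ Metric.closedBall (0 : ℂ) 1 :=
          closure_minimal (hE.trans Metric.ball_subset_closedBall) Metric.isClosed_closedBall hw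
        simpa using this
      · exact disjoint_left.1 hdisj hw (by simpa using h)
      · exact absurd (hmax (subset_closure hz)) (not_le.2 hlt)
  · obtain ⟨f, hf, hre, hlim⟩ := exists_re_tendsto_atTop hE hG
    have hnorm : ∀ z, ‖Complex.exp (-f z)‖ = Real.exp (-(f z).re) := fun z => by
      rw [Complex.norm_exp, Complex.neg_re]
    let S := sSup ((fun z => Real.exp (-(f z).re)) '' unitDisc)
    have hS : IsLUB ((fun z => Real.exp (-(f z).re)) '' unitDisc) S :=
      isLUB_csSup ⟨_, mem_image_of_mem _ h0⟩
        ⟨1, forall_mem_image.2 fun z hz => Real.exp_le_one_iff.2 (by linarith [hre z hz])⟩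
    have hS0 : 0 < S := (Real.exp_pos _).trans_le (hS.1 (mem_image_of_mem _ h0))
    have hSc : (S : ℂ) ≠ 0 := by exact_mod_cast hS0.ne'
    have hq : ∀ z, ‖Complex.exp (-f z) / S‖ = Real.exp (-(f z).re) / S := fun z => by
      rw [norm_div, hnorm, Complex.norm_real, Real.norm_of_nonneg hS0.le]
    refine ⟨fun z => Complex.exp (-f z) / S, hf.neg.cexp.div_const _,
      fun z _ => div_ne_zero (Complex.exp_ne_zero _) hSc, ⟨?_, ?_⟩, fun δ hδ => ?_,
      fun h => absurd h hdisj⟩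
    · refine forall_mem_image.2 fun z hz => ?_
      show ‖Complex.exp (-f z) / S‖ ≤ 1
      rw [hq, div_le_one hS0]
      exact hS.1 (mem_image_of_mem _ hz)
    · intro b hb
      have h1 : S ≤ b * S := hS.2 (forall_mem_image.2 fun z hz => by
        have h2 : ‖Complex.exp (-f z) / S‖ ≤ b := hb (mem_image_of_mem _ hz)
        rwa [hq, div_le_iff₀ hS0] at h2)
      exact le_of_mul_le_mul_right (by linarith) hS0
    · obtain ⟨ρ, hρ, h⟩ := hlim (-Real.log (δ * S))
      refine ⟨ρ, hρ, fun z hz hzρ => ?_⟩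
      show ‖Complex.exp (-f z) / S‖ < δ
      rw [hq, div_lt_iff₀ hS0, ← Real.exp_log (mul_pos hδ hS0)]
      exact Real.exp_lt_exp.2 (by linarith [h z hz hzρ])

end HardyStability
-- Decay of g_R, majorants, and the final estimates.
namespace HardyStability

variable {E : Set ℂ} {q : ℂ → ℂ}

/-- Functions small at finitely many points of `E` are controlled by their Blaschke product. -/
theorem exists_stabilityConst_le_prod (hE : E ⊆ unitDisc) (S : Finset ℂ) (hS : ↑S ⊆ E) {R : ℝ}
    (hR0 : 0 < R) (hR1 : R < 1) : ∃ Λ : ℝ, 0 ≤ Λ ∧ ∀ ε : ℝ, 0 ≤ ε →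
      stabilityConst E 1 ε R ≤ (1 + ε * Λ) / (1 - R) *
        (∏ a ∈ S, max R ‖a‖) ^ (R ^ 2 * (1 - R ^ 2) / 4) + ε * Λ := by
  classical
  -- Lagrange polynomials of a fixed finite set have a bound Λ on the disc independent of ε, so the
  -- interpolant of data at most ε is at most εΛ.
  let ℓ : ℂ → ℂ → ℂ := fun a w => (Lagrange.basis S id a).eval w
  have hℓ : ∀ a, Differentiable ℂ (ℓ a) := fun a => Polynomial.differentiable _
  obtain ⟨Λ, hΛ⟩ := (isCompact_closedBall (0 : ℂ) 1).bddAbove_image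
    (f := fun w => ∑ a ∈ S, ‖ℓ a w‖)
    (continuous_finsetSum _ fun a _ => (hℓ a).continuous.norm).continuousOn
  have hΛ' : ∀ w ∈ unitDisc, ∑ a ∈ S, ‖ℓ a w‖ ≤ Λ := fun w hw =>
    hΛ (mem_image_of_mem _ (Metric.ball_subset_closedBall hw))
  have hΛ0 : 0 ≤ Λ := (Finset.sum_nonneg fun a _ => norm_nonneg (ℓ a 0)).trans
    (hΛ' 0 (by simp [unitDisc]))
  refine ⟨Λ, hΛ0, fun ε hε => ?_⟩
  have hεΛ : 0 ≤ ε * Λ := mul_nonneg hε hΛ0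
  have hfac : 0 ≤ (1 + ε * Λ) / (1 - R) := div_nonneg (by linarith) (by linarith)
  have hnn : ∀ a ∈ S, 0 ≤ max R ‖a‖ := fun a _ => hR0.le.trans (le_max_left _ _)
  refine stabilityConst_le (add_nonneg (mul_nonneg hfac
    (Real.rpow_nonneg (Finset.prod_nonneg hnn) _)) hεΛ) fun g hg hgp hgE z hz => ?_
  let L : ℂ → ℂ := fun w => ∑ a ∈ S, g a * ℓ a w
  have hLd : DifferentiableOn ℂ L unitDisc :=
    DifferentiableOn.fun_sum fun a _ => (hℓ a).differentiableOn.const_mul _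
  have hLb : ∀ w ∈ unitDisc, ‖L w‖ ≤ ε * Λ := by
    intro w hw
    refine (norm_sum_le_of_le S (f := fun a => g a * ℓ a w) (n := fun a => ε * ‖ℓ a w‖)
      fun a ha => ?_).trans ?_
    · rw [norm_mul]
      exact mul_le_mul_of_nonneg_right (hgE a (hS ha)) (norm_nonneg _)
    · rw [← Finset.mul_sum]
      exact mul_le_mul_of_nonneg_left (hΛ' w hw) hε
  have hLS : ∀ a ∈ S, L a = g a := by
    intro a ha
    refine (Finset.sum_eq_single_of_mem a ha fun b hb hba => ?_).trans ?_
    · show g b * (Lagrange.basis S id b).eval (id a) = 0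
      rw [Lagrange.eval_basis_of_ne hba ha, mul_zero]
    · show g a * (Lagrange.basis S id a).eval (id a) = g a
      rw [Lagrange.eval_basis_self Function.injective_id.injOn ha, mul_one]
  have h1 := norm_sub_le_prod_blaschkeFactor hg le_rfl hgp hLd hεΛ hLb S
    (fun a ha => ⟨hE (hS ha), hLS a ha⟩) hR1 hz
  have h2 : ∏ a ∈ S, ‖blaschkeFactor a z‖ ≤
      (∏ a ∈ S, max R ‖a‖) ^ (R ^ 2 * (1 - R ^ 2) / 4) := by
    rw [← Real.finsetProd_rpow _ _ hnn]
    exact Finset.prod_le_prod (fun _ _ => norm_nonneg _) fun a ha =>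
      norm_blaschkeFactor_le_max_rpow hR0 hR1 (mem_unitDisc.1 (hE (hS ha))) hz
  have h3 := mul_le_mul_of_nonneg_left h2 hfac
  have h4 : ‖g z‖ ≤ ‖g z - L z‖ + ‖L z‖ := by simpa using norm_add_le (g z - L z) (L z)
  linarith [hLb z (mem_unitDisc.2 (hz.trans_lt hR1))]

theorem exists_prod_max_lt (hE : E ⊆ unitDisc) (hB : ContainsNonBlaschke E) {R : ℝ}
    (hR0 : 0 < R) (hR1 : R < 1) {δ : ℝ} (hδ : 0 < δ) :
    ∃ S : Finset ℂ, ↑S ⊆ E ∧ ∏ a ∈ S, max R ‖a‖ < δ := by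
  classical
  obtain ⟨z, hinj, hz, hns⟩ := hB
  have hz1 : ∀ j, ‖z j‖ < 1 := fun j => mem_unitDisc.1 (hE (hz j))
  have hlim := (not_summable_iff_tendsto_nat_atTop_of_nonneg
    fun j => (sub_pos.2 (hz1 j)).le).1 hns
  obtain ⟨N, hN⟩ := (hlim.eventually_gt_atTop (-Real.log δ / (1 - R))).exists
  refine ⟨(Finset.range N).image z, ?_, ?_⟩
  · intro a ha
    obtain ⟨j, -, rfl⟩ := Finset.mem_image.1 (Finset.mem_coe.1 ha)
    exact hz j
  rw [Finset.prod_image fun _ _ _ _ h => hinj h]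
  have h1 : ∏ j ∈ Finset.range N, max R ‖z j‖ ≤
      ∏ j ∈ Finset.range N, Real.exp (-((1 - R) * (1 - ‖z j‖))) := by
    -- Both R and |z_j| are at most 1 - (1 - R)(1 - |z_j|), so divergence of the sum of 1 - |z_j|
    -- drives the product to 0.
    refine Finset.prod_le_prod (fun j _ => hR0.le.trans (le_max_left _ _)) fun j _ => ?_
    refine le_trans (max_le ?_ ?_) (Real.add_one_le_exp _)
    · nlinarith [norm_nonneg (z j), mul_nonneg (sub_pos.2 hR1).le (norm_nonneg (z j))]
    · nlinarith [mul_nonneg hR0.le (sub_pos.2 (hz1 j)).le]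
  refine h1.trans_lt ?_
  rw [← Real.exp_sum, Finset.sum_neg_distrib, ← Finset.mul_sum, ← Real.exp_log hδ]
  refine Real.exp_lt_exp.2 ?_
  rw [div_lt_iff₀ (by linarith)] at hN
  linarith

theorem tendsto_gFun (hE : E ⊆ unitDisc) (hne : E.Nonempty) (hq : IsWeight E q)
    (hB : ContainsNonBlaschke E) {R : ℝ} (hR0 : 0 < R) (hR1 : R < 1) :
    Tendsto (gFun E q R) (𝓝[>] 0) (𝓝 0) := by
  have hα : 0 < R ^ 2 * (1 - R ^ 2) / 4 := by
    have : 0 < 1 - R ^ 2 := by nlinarith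
    positivity
  set α := R ^ 2 * (1 - R ^ 2) / 4 with hαdef
  have hR : 0 < 1 - R := by linarith
  rw [tendsto_order]
  refine ⟨fun a ha => ?_, fun η hη => ?_⟩
  · filter_upwards [self_mem_nhdsWithin] with ε hε
    exact ha.trans (gFun_pos hR0 hR1 hE hne hq hε)
  -- Chosen so that the Blaschke term is at most η/2 once εΛ < 1; the remaining term εΛ is below η/2
  -- for small ε.
  obtain ⟨S, hS, hSδ⟩ := exists_prod_max_lt hE hB hR0 hR1
    (δ := (η * (1 - R) / 4) ^ α⁻¹) (Real.rpow_pos_of_pos (by positivity) _)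
  obtain ⟨Λ, hΛ0, hΛ⟩ := exists_stabilityConst_le_prod hE S hS hR0 hR1
  have hP0 : 0 ≤ ∏ a ∈ S, max R ‖a‖ :=
    Finset.prod_nonneg fun a _ => hR0.le.trans (le_max_left _ _)
  have hP : (∏ a ∈ S, max R ‖a‖) ^ α < η * (1 - R) / 4 :=
    (Real.lt_rpow_inv_iff_of_pos hP0 (by positivity) hα).1 hSδ
  have hlim : Tendsto (fun ε : ℝ => ε * Λ) (𝓝[>] 0) (𝓝 0) := by
    have : Tendsto (fun ε : ℝ => ε * Λ) (𝓝 0) (𝓝 (0 * Λ)) := tendsto_id.mul_const Λ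
    rw [zero_mul] at this
    exact this.mono_left nhdsWithin_le_nhds
  filter_upwards [self_mem_nhdsWithin, hlim.eventually (gt_mem_nhds (half_pos hη)),
    hlim.eventually (gt_mem_nhds one_pos)] with ε hε h1 h2
  refine (gFun_le_stabilityConst hR0 hR1 hE hq le_rfl (mem_Ioi.1 hε).le).trans_lt
    ((hΛ ε (mem_Ioi.1 hε).le).trans_lt ?_)
  have h3 : (1 + ε * Λ) / (1 - R) * (∏ a ∈ S, max R ‖a‖) ^ α ≤
      2 / (1 - R) * (η * (1 - R) / 4) := by
    refine mul_le_mul ?_ hP.le (Real.rpow_nonneg hP0 _) (by positivity)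
    gcongr
    linarith
  have h4 : 2 / (1 - R) * (η * (1 - R) / 4) = η / 2 := by
    field_simp
    norm_num
  linarith

theorem exists_isMajorant (hE : E ⊆ unitDisc) (hinf : E.Infinite) (hq : IsWeight E q) :
    ∃ h : ℝ → ℝ, IsMajorant E q h := by
  -- M_k times a ramp equal to 1 up to k and to 0 from k + 1 on. Since M_k ≤ 1, all are 1-Lipschitz
  -- in x, hence so is their supremum; the added 1/x below gives positivity at once.
  let s : ℕ → ℝ → ℝ := fun k x => mMin E q k * max 0 (min 1 (k + 1 - x))
  have hM0 : ∀ k, 0 ≤ mMin E q k := fun k => (mMin_pos hE hinf hq k).le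
  have hM1 := mMin_le_one hE hinf hq
  have hs0 : ∀ k x, 0 ≤ s k x := fun k x => mul_nonneg (hM0 k) (le_max_left _ _)
  have hsM : ∀ k x, s k x ≤ mMin E q k := fun k x =>
    mul_le_of_le_one_right (hM0 k) (max_le zero_le_one (min_le_left _ _))
  have hbdd : ∀ x, BddAbove (range fun k => s k x) := fun x =>
    ⟨1, forall_mem_range.2 fun k => (hsM k x).trans (hM1 k)⟩
  have hLip : ∀ k x y, s k x ≤ s k y + |x - y| := by
    intro k x y
    have h1 : max 0 (min 1 ((k : ℝ) + 1 - x)) ≤ max 0 (min 1 (k + 1 - y)) + |x - y| := by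
      refine max_le (add_nonneg (le_max_left _ _) (abs_nonneg _)) ?_
      rw [← sub_le_iff_le_add]
      refine le_max_of_le_right (le_min ?_ ?_)
      · linarith [min_le_left 1 ((k : ℝ) + 1 - x), abs_nonneg (x - y)]
      · linarith [min_le_right 1 ((k : ℝ) + 1 - x), neg_abs_le (x - y)]
    calc s k x ≤ mMin E q k * (max 0 (min 1 (k + 1 - y)) + |x - y|) :=
          mul_le_mul_of_nonneg_left h1 (hM0 k)
      _ ≤ s k y + |x - y| := by
          rw [mul_add]
          exact add_le_add le_rfl (mul_le_of_le_one_left (abs_nonneg _) (hM1 k))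
  have hsup0 : ∀ x, 0 ≤ ⨆ k, s k x := fun x => Real.iSup_nonneg fun k => hs0 k x
  refine ⟨fun x => 1 / x + ⨆ k, s k x, ?_, fun x hx => ?_, fun x hx y hy hxy => ?_, ?_,
    fun n hn => ?_⟩
  · refine ContinuousOn.add (continuousOn_const.div continuousOn_id
      fun x hx => (zero_lt_one.trans_le hx).ne') (Continuous.continuousOn ?_)
    have hL : LipschitzWith 1 fun x => ⨆ k, s k x := LipschitzWith.of_le_add fun x y =>
      ciSup_le fun k => (hLip k x y).trans (add_le_add (le_ciSup (hbdd y) k) le_rfl)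
    exact hL.continuous
  · have : 0 < 1 / x := one_div_pos.2 (by linarith)
    linarith [hsup0 x]
  · refine add_le_add (one_div_le_one_div_of_le (zero_lt_one.trans_le hx) hxy)
      (ciSup_mono (hbdd x) fun k => mul_le_mul_of_nonneg_left ?_ (hM0 k))
    exact max_le_max le_rfl (min_le_min le_rfl (by linarith))
  · have h1 : Tendsto (fun x : ℝ => 1 / x) atTop (𝓝 0) := by
      simpa using tendsto_inv_atTop_zero (𝕜 := ℝ)
    have h2 : Tendsto (fun x : ℝ => ⨆ k, s k x) atTop (𝓝 0) := by
      rw [tendsto_order]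
      refine ⟨fun a ha => Eventually.of_forall fun x => ha.trans_le (hsup0 x), fun δ hδ => ?_⟩
      obtain ⟨N, hN⟩ := eventually_atTop.1
        ((tendsto_mMin hE hinf hq).eventually (gt_mem_nhds (half_pos hδ)))
      filter_upwards [eventually_ge_atTop (N : ℝ)] with x hx
      refine lt_of_le_of_lt (ciSup_le fun k => ?_) (half_lt_self hδ)
      rcases le_or_gt N k with h | h
      · exact (hsM k x).trans (hN k h).le
      · have h3 : (k : ℝ) + 1 ≤ N := by exact_mod_cast h
        have h4 : max 0 (min 1 ((k : ℝ) + 1 - x)) = 0 :=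
          max_eq_left ((min_le_right _ _).trans (by linarith))
        simp only [s, h4, mul_zero]
        exact (half_pos hδ).le
    simpa using h1.add h2
  · have h1 : s n n = mMin E q n := by simp [s]
    have h2 : (0 : ℝ) ≤ 1 / n := by positivity
    have h3 := le_ciSup (hbdd n) n
    simp only [h1] at h3
    show mMin E q n ≤ 1 / (n : ℝ) + ⨆ k, s k n
    linarith

theorem IsMajorant.exists_eq {h : ℝ → ℝ} (hh : IsMajorant E q h) {ε : ℝ} (hε0 : 0 < ε)
    (hε : ε ≤ h 1 / 2) : ∃ x : ℝ, 1 ≤ x ∧ h x / (x + 1) = ε := by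
  obtain ⟨X, hX, hX1⟩ := ((hh.tendsto_zero.eventually (gt_mem_nhds hε0)).and
    (eventually_ge_atTop 1)).exists
  have hc : ContinuousOn (fun x => h x / (x + 1)) (Icc 1 X) := by
    refine ContinuousOn.div (hh.continuousOn.mono Icc_subset_Ici_self) (by fun_prop) fun x hx => ?_
    linarith [hx.1]
  have hmem : ε ∈ Icc (h X / (X + 1)) (h 1 / (1 + 1)) := by
    refine ⟨?_, by norm_num; exact hε⟩
    exact (div_le_self (hh.pos X hX1).le (by linarith)).trans hX.le
  obtain ⟨x, hx, hxe⟩ := intermediate_value_Icc' hX1 hc hmem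
  exact ⟨x, hx.1, hxe⟩

/-- The solution of `ε = h(x) / (x + 1)` is large when `ε` is small. -/
theorem IsMajorant.exists_forall_lt {h : ℝ → ℝ} (hh : IsMajorant E q h) {δ : ℝ} (hδ : 0 < δ) :
    ∃ ε₀ : ℝ, 0 < ε₀ ∧ ε₀ ≤ h 1 / 2 ∧ ∀ ε ∈ Ioo 0 ε₀, ∃ x : ℝ, 1 ≤ x ∧ h x / (x + 1) = ε ∧
      phi h ε = h x ∧ h x < δ := by
  obtain ⟨X, hX, hX1⟩ := ((hh.tendsto_zero.eventually (gt_mem_nhds hδ)).and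
    (eventually_ge_atTop 1)).exists
  -- A solution x ≤ X would give ε ≥ h(X)/(X+1); hence x > X and h(x) ≤ h(X) < δ.
  refine ⟨min (h 1 / 2) (h X / (X + 1)), lt_min (half_pos (hh.pos 1 le_rfl))
    (div_pos (hh.pos X hX1) (by linarith)), min_le_left _ _, fun ε hε => ?_⟩
  obtain ⟨x, hx, hxe⟩ := hh.exists_eq hε.1 (hε.2.le.trans (min_le_left _ _))
  refine ⟨x, hx, hxe, hxe ▸ phi_apply hh.pos hh.antitoneOn hx, ?_⟩
  by_contra! hlt
  have hxX : x ≤ X := by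
    by_contra! hlt'
    linarith [hh.antitoneOn (mem_Ici.2 hX1) (mem_Ici.2 hx) hlt'.le]
  have h1 : h X / (X + 1) ≤ h x / (x + 1) :=
    div_le_div₀ (hh.pos x hx).le (hh.antitoneOn (mem_Ici.2 hx) (mem_Ici.2 hX1) hxX)
      (by linarith) (by linarith)
  linarith [hε.2.trans_le (min_le_right _ _)]

theorem IsMajorant.stabilityConst_le {R : ℝ} (hR0 : 0 < R) (hR1 : R < 1) (hE : E ⊆ unitDisc)
    (hinf : E.Infinite) (hq : IsWeight E q) {h : ℝ → ℝ} (hh : IsMajorant E q h) {x : ℝ}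
    (hx : 1 ≤ x) (hx0 : h x < mMin E q 0) {p : ℝ≥0∞} (hp : 1 ≤ p) :
    stabilityConst E p (h x / (x + 1)) R ≤ (R ^ (-(R ^ 2 * (1 - R ^ 2) / 4)) + 2 / (1 - R)) *
      ‖q 0‖ ^ (-(R ^ 2 * (1 - R ^ 2) / 4)) * gFun E q R (h x) ^ (R ^ 2 * (1 - R ^ 2) / 4) := by
  classical
  have hfl := Nat.lt_floor_add_one x
  have hex : mMin E q (⌊x⌋₊ + 1) ≤ h x := by
    refine (hh.le _ (Nat.le_add_left 1 _)).trans ?_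
    push_cast
    exact hh.antitoneOn (mem_Ici.2 hx) (mem_Ici.2 (by linarith)) hfl.le
  -- The first such index is n + 1: it is nonzero because h(x) < M_0, and at most ⌊x⌋ + 1 ≤ x + 1.
  -- So (n+1)h(x)/(x+1) ≤ h(x) < M_n, as interpolation requires.
  have hP : ∃ k, mMin E q k ≤ h x := ⟨_, hex⟩
  obtain ⟨n, hn⟩ : ∃ n, Nat.find hP = n + 1 :=
    Nat.exists_eq_succ_of_ne_zero fun h0 => by
      have := Nat.find_spec hP
      rw [h0] at this
      linarith
  have h1 : mMin E q (n + 1) ≤ h x := hn ▸ Nat.find_spec hP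
  have h2 : h x < mMin E q n := not_le.1 (Nat.find_min hP (by omega))
  have h3 : n + 1 ≤ ⌊x⌋₊ + 1 := hn ▸ Nat.find_min' hP hex
  have h4 : (n : ℝ) + 1 ≤ x + 1 := by
    have : (n : ℝ) ≤ ⌊x⌋₊ := by exact_mod_cast Nat.le_of_succ_le_succ h3
    linarith [Nat.floor_le (show 0 ≤ x by linarith)]
  refine stabilityConst_le_gFun hR0 hR1 hE hinf hq h1 (le_trans ?_ h2.le) hp
  rw [mul_div_assoc', div_le_iff₀ (by linarith), mul_comm]
  exact mul_le_mul_of_nonneg_left h4 (hh.pos x hx).le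

theorem isMajorant_rpow (hE : E ⊆ unitDisc) (hinf : E.Infinite) (hq : IsWeight E q) {A σ : ℝ}
    {N : ℕ} (hσ : 0 < σ) (hA : ∀ n : ℕ, N ≤ n → mMin E q n ≤ A * (n : ℝ) ^ (-σ)) :
    ∃ A' : ℝ, 0 < A' ∧ IsMajorant E q fun x => A' * x ^ (-σ) := by
  -- The entry N^σ covers n < N, where only M_n ≤ 1 is known; the entry 1 makes the constant
  -- positive.
  have hA' : 0 < max 1 (max A ((N : ℝ) ^ σ)) := one_pos.trans_le (le_max_left _ _)
  refine ⟨max 1 (max A ((N : ℝ) ^ σ)), hA', ?_, fun x hx => ?_, fun x hx y hy hxy => ?_, ?_,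
    fun n hn => ?_⟩
  · exact continuousOn_const.mul (continuousOn_id.rpow_const
      fun x hx => Or.inl (zero_lt_one.trans_le hx).ne')
  · exact mul_pos hA' (Real.rpow_pos_of_pos (by linarith) _)
  · exact mul_le_mul_of_nonneg_left (Real.rpow_le_rpow_of_nonpos (zero_lt_one.trans_le hx) hxy
      (by linarith)) hA'.le
  · simpa using (tendsto_rpow_neg_atTop hσ).const_mul (max 1 (max A ((N : ℝ) ^ σ)))
  · have hn0 : (0 : ℝ) < n := by exact_mod_cast hn
    have hpos := Real.rpow_pos_of_pos hn0 (-σ)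
    rcases le_or_gt N n with h | h
    · exact (hA n h).trans (mul_le_mul_of_nonneg_right
        ((le_max_left _ _).trans (le_max_right _ _)) hpos.le)
    · refine (mMin_le_one hE hinf hq n).trans ?_
      have h1 : (n : ℝ) ^ σ ≤ (N : ℝ) ^ σ :=
        Real.rpow_le_rpow hn0.le (by exact_mod_cast h.le) hσ.le
      have h2 : (n : ℝ) ^ σ * (n : ℝ) ^ (-σ) = 1 := by
        rw [← Real.rpow_add hn0, add_neg_cancel, Real.rpow_zero]
      rw [← h2]
      exact mul_le_mul_of_nonneg_right
        (h1.trans ((le_max_right _ _).trans (le_max_right _ _))) hpos.le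

/-- For `h(x) = A x^{-σ}`, `φ(ε) ≤ ε^{1/l}` for small `φ(ε)`, if `l > 1 + 1 / σ`. -/
theorem exists_rpow_le {A σ l : ℝ} (hA : 0 < A) (hσ : 0 < σ) (hl : 1 + 1 / σ < l) :
    ∃ δ : ℝ, 0 < δ ∧ ∀ x : ℝ, 1 ≤ x → A * x ^ (-σ) < δ →
      A * x ^ (-σ) ≤ (A * x ^ (-σ) / (x + 1)) ^ (1 / l) := by
  have hσ' : 0 < 1 / σ := one_div_pos.2 hσ
  have hl0 : 0 < l := by linarith
  -- With y = A x^{-σ} the claim is y^l (x + 1) ≤ y. As x y^{1/σ} = A^{1/σ}, it follows from 2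
  -- A^{1/σ} y^τ ≤ 1; the positive exponent τ absorbs the constant for small y.
  set τ := l - 1 - 1 / σ with hτ
  have hτ0 : 0 < τ := by linarith
  have hlim : Tendsto (fun y : ℝ => 2 * A ^ (1 / σ) * y ^ τ) (𝓝[>] 0) (𝓝 0) := by
    have : ContinuousAt (fun y : ℝ => 2 * A ^ (1 / σ) * y ^ τ) 0 :=
      continuousAt_const.mul (Real.continuousAt_rpow_const _ _ (Or.inr hτ0.le))
    have h2 := this.tendsto
    rw [Real.zero_rpow hτ0.ne', mul_zero] at h2
    exact h2.mono_left nhdsWithin_le_nhds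
  obtain ⟨δ, hδ, hδ'⟩ := mem_nhdsGT_iff_exists_Ioo_subset.1
    (hlim.eventually (gt_mem_nhds one_pos))
  refine ⟨δ, hδ, fun x hx hxδ => ?_⟩
  have hx0 : 0 < x := by linarith
  set y := A * x ^ (-σ) with hy
  have hy0 : 0 < y := mul_pos hA (Real.rpow_pos_of_pos hx0 _)
  have h1 : 2 * A ^ (1 / σ) * y ^ τ < 1 := hδ' ⟨hy0, hxδ⟩
  have h2 : y ^ (1 / σ) * x = A ^ (1 / σ) := by
    rw [hy, Real.mul_rpow hA.le (Real.rpow_nonneg hx0.le _), ← Real.rpow_mul hx0.le, neg_mul,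
      mul_one_div_cancel hσ.ne', Real.rpow_neg_one, mul_assoc, inv_mul_cancel₀ hx0.ne', mul_one]
  have h3 : y ^ l = y * (y ^ τ * y ^ (1 / σ)) := by
    rw [← Real.rpow_add hy0, ← Real.rpow_one_add' hy0.le (by linarith)]
    congr 1
    rw [hτ]
    ring
  rw [one_div, Real.le_rpow_inv_iff_of_pos hy0.le (div_nonneg hy0.le (by linarith)) hl0,
    le_div_iff₀ (by linarith), h3]
  have hyτ : 0 ≤ y ^ τ * y ^ (1 / σ) := by positivity
  have h4 : y ^ τ * y ^ (1 / σ) * (x + 1) ≤ 1 := by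
    have h5 : y ^ τ * y ^ (1 / σ) * (x + 1) ≤ y ^ τ * y ^ (1 / σ) * (2 * x) :=
      mul_le_mul_of_nonneg_left (by linarith) hyτ
    have h6 : y ^ τ * y ^ (1 / σ) * (2 * x) = 2 * A ^ (1 / σ) * y ^ τ := by
      rw [← h2]
      ring
    linarith
  rw [mul_assoc]
  exact mul_le_of_le_one_right hy0.le h4

end HardyStability

/-! ### Assembly of the theorem. -/

theorem theorem4p1 (R : ℝ) (hR0 : 0 < R) (hR1 : R < 1) :
    ∃ α : ℝ, 0 < α ∧
    ∀ E : Set ℂ, E ⊆ unitDisc → E.Infinite → ConditionG E →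
    (∃ q : ℂ → ℂ, IsWeight E q) ∧
    ∀ q : ℂ → ℂ, IsWeight E q →
      (∀ ε ∈ Ioc (0 : ℝ) 1, 0 < gFun E q R ε) ∧
      MonotoneOn (gFun E q R) (Ioc 0 1) ∧
      (ContainsNonBlaschke E → Tendsto (gFun E q R) (𝓝[>] 0) (𝓝 0)) ∧
      (∀ ε ∈ Ioc (0 : ℝ) 1, ∀ κ : ℝ, 0 < κ →
        gFun E q R ε ^ (⌊κ⌋₊ + 1) ≤ gFun E q R (ε ^ κ) ∧
        gFun E q R (ε ^ κ) ≤ gFun E q R ε ^ (1 / ((⌊1 / κ⌋₊ : ℝ) + 1))) ∧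
      (∃ h : ℝ → ℝ, IsMajorant E q h) ∧
      ∀ p : ℝ≥0∞, 1 ≤ p → ∃ C : ℝ, 0 < C ∧
        (∀ h : ℝ → ℝ, IsMajorant E q h →
          ∃ ε₀ : ℝ, 0 < ε₀ ∧ ε₀ ≤ h 1 / 2 ∧ ∀ ε ∈ Ioo 0 ε₀,
            phi h ε ∈ Ioc (0 : ℝ) 1 ∧
            gFun E q R ε ≤ stabilityConst E p ε R ∧
            stabilityConst E p ε R ≤ C * gFun E q R (phi h ε) ^ α) ∧
        (∀ (A σ : ℝ) (N : ℕ), 0 < σ → (∀ n : ℕ, N ≤ n → mMin E q n ≤ A * (n : ℝ) ^ (-σ)) →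
          ∃ ε₀ : ℝ, 0 < ε₀ ∧ ∀ ε ∈ Ioo 0 ε₀,
            gFun E q R ε ≤ stabilityConst E p ε R ∧
            stabilityConst E p ε R ≤
              C * gFun E q R ε ^ (α / ((⌊1 / (σ / (1 + σ))⌋₊ : ℝ) + 1))) := by
  have hα : 0 < R ^ 2 * (1 - R ^ 2) / 4 := by
    have : 0 < 1 - R ^ 2 := by nlinarith
    positivity
  refine ⟨R ^ 2 * (1 - R ^ 2) / 4, hα, fun E hE hinf hG => ⟨exists_isWeight hE hG, fun q hq => ?_⟩⟩
  have hne := hinf.nonempty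
  have hgpos : ∀ {ε : ℝ}, 0 < ε → 0 < gFun E q R ε := fun hε => gFun_pos hR0 hR1 hE hne hq hε
  refine ⟨fun ε hε => hgpos hε.1, fun ε hε δ _ h => gFun_mono hR0 hR1 hE hne hq hε.1 h,
    fun hB => tendsto_gFun hE hne hq hB hR0 hR1, fun ε hε κ hκ =>
      ⟨gFun_pow_le hR0 hR1 hE hne hq hε κ, gFun_rpow_le hR0 hR1 hE hne hq hε hκ⟩,
    exists_isMajorant hE hinf hq, fun p hp => ?_⟩
  set α := R ^ 2 * (1 - R ^ 2) / 4 with hαdef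
  -- This constant serves every p and both upper bounds.
  have hC : 0 < (R ^ (-α) + 2 / (1 - R)) * ‖q 0‖ ^ (-α) :=
    mul_pos (add_pos (Real.rpow_pos_of_pos hR0 _) (div_pos two_pos (by linarith)))
      (Real.rpow_pos_of_pos (hq.norm_pos (by simp [unitDisc])) _)
  refine ⟨_, hC, fun h hh => ?_, fun A σ N hσ hA => ?_⟩
  · obtain ⟨ε₀, hε₀, hε₀', H⟩ := hh.exists_forall_lt (lt_min one_pos (mMin_pos hE hinf hq 0))
    refine ⟨ε₀, hε₀, hε₀', fun ε hε => ?_⟩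
    obtain ⟨x, hx, rfl, hphi, hlt⟩ := H ε hε
    rw [hphi]
    exact ⟨⟨hh.pos x hx, hlt.le.trans (min_le_left _ _)⟩,
      gFun_le_stabilityConst hR0 hR1 hE hq hp hε.1.le,
      hh.stabilityConst_le hR0 hR1 hE hinf hq hx (hlt.trans_le (min_le_right _ _)) hp⟩
  · obtain ⟨A', hA', hh⟩ := isMajorant_rpow hE hinf hq hσ hA
    have hκ₀ : 1 / (σ / (1 + σ)) = 1 + 1 / σ := by field_simp; ring
    rw [hκ₀]
    set m := ⌊1 + 1 / σ⌋₊ with hm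
    have hm1 : 1 + 1 / σ < m + 1 := Nat.lt_floor_add_one _
    -- At the critical value 1/κ₀ = 1 + 1/σ the constant A' could not be absorbed. A slightly larger
    -- l leaves room for it and has the same integer part, so the exponent in the conclusion is
    -- unchanged.
    obtain ⟨l, hl1, hl2⟩ := exists_between hm1
    have hσ' : 0 < 1 / σ := one_div_pos.2 hσ
    have hl0 : 0 < l := by linarith
    have hml : ⌊l⌋₊ = m := (Nat.floor_eq_iff hl0.le).2
      ⟨(Nat.floor_le (by linarith)).trans hl1.le, hl2⟩
    obtain ⟨δ, hδ, hδ'⟩ := exists_rpow_le hA' hσ hl1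
    obtain ⟨ε₀, hε₀, -, H⟩ := hh.exists_forall_lt
      (lt_min (lt_min one_pos hδ) (mMin_pos hE hinf hq 0))
    refine ⟨ε₀, hε₀, fun ε hε => ?_⟩
    obtain ⟨x, hx, hxe, -, hlt⟩ := H ε hε
    have hx1 : A' * x ^ (-σ) < 1 := hlt.trans_le ((min_le_left _ _).trans (min_le_left _ _))
    have hxδ : A' * x ^ (-σ) < δ := hlt.trans_le ((min_le_left _ _).trans (min_le_right _ _))
    have hε1 : ε ≤ 1 := hxe ▸ (div_le_self (hh.pos x hx).le (by linarith)).trans hx1.le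
    refine ⟨gFun_le_stabilityConst hR0 hR1 hE hq hp hε.1.le, ?_⟩
    have h1 := hh.stabilityConst_le hR0 hR1 hE hinf hq hx (hlt.trans_le (min_le_right _ _)) hp
    have h2 := hδ' x hx hxδ
    rw [hxe] at h1 h2
    refine h1.trans (mul_le_mul_of_nonneg_left ?_ hC.le)
    have h3 : gFun E q R (A' * x ^ (-σ)) ≤ gFun E q R ε ^ (1 / ((m : ℝ) + 1)) := by
      refine (gFun_mono hR0 hR1 hE hne hq (hh.pos x hx) h2).trans ?_
      have := gFun_rpow_le hR0 hR1 hE hne hq ⟨hε.1, hε1⟩ (one_div_pos.2 hl0)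
      rwa [one_div_one_div, hml] at this
    refine (Real.rpow_le_rpow (hgpos (hh.pos x hx)).le h3 hα.le).trans (le_of_eq ?_)
    rw [← Real.rpow_mul (hgpos hε.1).le]
    congr 1
    ring
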